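/- **Theorem (Oracle Optimality in Predictive Loss).** *Model.* Let $b_i,h_i,\sigma_{p,i},\sigma_{f,i}>0$ and $\theta_i\in\mathbb R$ ($i\ge 1$) be sequences and put $\tilde b_i=b_i/(b_i+h_i)$. $N(\mu,\sigma)$ denotes the normal law with mean $\mu$ and variance $\sigma$; $\phi,\Phi$ are the standard normal density and distribution function. For each $n$ the past data $\boldsymbol X=(X_1,\dots,X_n)$ have independent coordinates $X_i\sim N(\theta_i,\sigma_{p,i})$. For $\hat{\boldsymbol q}\in\mathbb R^n$ let $$L_n(\boldsymbol\theta,\hat{\boldsymbol q})=\frac1n\sum_{i=1}^n \mathbb E_{Y_i\sim N(\theta_i,\sigma_{f,i})}\big[b_i(Y_i-\hat q_i)^++h_i(\hat q_i-Y_i)^+\big].$$ For $\tau\in[0,\infty]$ let $\alpha_i(\tau)=\tau/(\tau+\sigma_{p,i})$ (with $\alpha_i(\infty)=1$) and $$\hat q_i(\tau)=\alpha_i(\tau)X_i+\sqrt{\sigma_{f,i}+\alpha_i(\tau)\sigma_{p,i}}\;\Phi^{-1}(\tilde b_i),\qquad \hat{\boldsymbol q}(\tau)=(\hat q_i(\tau))_{i\le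 n}.$$ *Assumptions.* (A1) $0<\inf_i\tilde b_i\le\sup_i\tilde b_i<1$ and $\sup_i(b_i+h_i)<\infty$. (A2) $\limsup_{n}\frac1n\sum_{i=1}^n|\theta_i|<\infty$. (A3) $\sup_i\sigma_{p,i}/\sigma_{f,i}<1/(4e)$, $\sup_i\sigma_{f,i}<\infty$ and $\inf_i\sigma_{p,i}>0$. *Risk estimate.* Let $\gamma(i)$ be any numbers with $0<\gamma(i)<1/\sqrt{4e}-\sqrt{\sigma_{p,i}/\sigma_{f,i}}$ and $\inf_i\gamma(i)>0$. Put $$\lambda_n(i)=\gamma(i)\sqrt{2\log n},\qquad K_n(i)=1+\Big\lceil e^2\big(\gamma(i)+\sqrt{2\sigma_{p,i}/\sigma_{f,i}}\big)^2\,2\log n\Big\rceil,$$ $$c_i(\tau)=\sqrt{\frac{\sigma_{f,i}+\alpha_i(\tau)\sigma_{p,i}}{\sigma_{f,i}+\alpha_i(\tau)^2\sigma_{p,i}}}\;\Phi^{-1}(\tilde b_i),\qquad d_i(\tau)=-\frac{1-\alpha_i(\tau)}{\sqrt{\sigma_{f,i}+\sigma_{p,i}\alpha_i(\tau)^2}}.$$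 With $Z_i\sim N(0,1)$ independent of $\boldsymbol X$ let $$U_i(\tau)=c_i(\tau)+d_i(\tau)(X_i+\sqrt{\sigma_{p,i}}Z_i),\qquad V_i(\tau)=c_i(\tau)+d_i(\tau)(X_i-\sqrt{\sigma_{p,i}}Z_i).$$ Let $G(w,\beta)=\phi(w)+w\Phi(w)-\beta w$ with $G'=\partial G/\partial w$, let $H_k$ be the probabilists' Hermite polynomials, $v_i(\tau)=2\sigma_{p,i}d_i(\tau)^2$, and $$S_i(u)=G(0,\tilde b_i)+G'(0,\tilde b_i)u+\phi(0)\sum_{k=0}^{K_n(i)-2}\frac{(-1)^kH_k(0)}{(k+2)!}\,v_i(\tau)^{(k+2)/2}H_{k+2}\!\Big(\frac{u}{\sqrt{v_i(\tau)}}\Big)$$ (if $v_i(\tau)=0$, the factor $v^{m/2}H_m(u/\sqrt v)$ is read as its limit $u^m$). Let $\tilde S_i(u)=\max\{-n,\min\{n,S_i(u)\}\}$ and $$\hat T_i(X_i,Z_i,\tau)=\begin{cases}-\tilde b_i\,U_i(\tau), & V_i(\tau)<-\lambda_n(i),\\ \tilde S_i(U_i(\tau)), & |V_i(\tau)|\le\lambda_n(i),\\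 (1-\tilde b_i)\,U_i(\tau), & V_i(\tau)>\lambda_n(i),\end{cases}\qquad \hat T_i(X_i,\tau)=\mathbb E\big[\hat T_i(X_i,Z_i,\tau)\mid\boldsymbol X\big],$$ $$\widehat{\mathrm{ARE}}_n(\tau)=\frac1n\sum_{i=1}^n(b_i+h_i)\sqrt{\sigma_{f,i}+\sigma_{p,i}\alpha_i(\tau)^2}\;\hat T_i(X_i,\tau).$$ *Grid.* Let $a_n=\log\log n$ and let $C_1,\dots,C_4$ be any constants such that for all large $n$: $\sup_{i\le n}(b_i+h_i)\le C_1$, $\sup_{i\le n}\max\{\sigma_{p,i},\sigma_{p,i}^{-1}\}\le C_2$, $\big(\sup_{i\le n}\sigma_{p,i}/\sigma_{f,i}\big)\big(\sup_{i\le n}|\Phi^{-1}(\tilde b_i)|\big)\le C_3$ and $\frac1n\sum_{i\le n}|\theta_i|\le C_4\sqrt{a_n}$. Put $\delta_n=\{2C_1C_2(2\phi(0)+C_3+\sqrt{a_n}\,C_4+a_n)\}^{-1}$ and $$\Lambda_n=\Big\{\frac{t}{1-t}\;:\;t=(j-1)\delta_n,\ 1\le j\le\lceil 1/\delta_n\rceil\Big\}\subset[0,\infty].$$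 Let $\hat\tau^{\mathrm{ARE}}_n$ be any minimizer of $\widehat{\mathrm{ARE}}_n$ over $\Lambda_n$, and $\tau^{\mathsf{OR}}_n$ any minimizer of $\tau\mapsto L_n(\boldsymbol\theta,\hat{\boldsymbol q}(\tau))$ over $[0,\infty]$. *Conclusion.* Under A1 and A3, for every $\boldsymbol\theta$ satisfying A2 and every $\epsilon>0$, $$\lim_{n\to\infty}\Pr\Big\{L_n\big(\boldsymbol\theta,\hat{\boldsymbol q}(\hat\tau^{\mathrm{ARE}}_n)\big)\ \ge\ L_n\big(\boldsymbol\theta,\hat{\boldsymbol q}(\tau^{\mathsf{OR}}_n)\big)+\epsilon\Big\}=0 .$$ -/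

import Mathlib

open MeasureTheory ProbabilityTheory Filter Topology
open scoped ENNReal NNReal

namespace CheckLoss

noncomputable section

/-- Known data of the sequence of Gaussian prediction problems under check loss.  Coordinate `i` has
past variance `σp i`, future variance `σf i`, under-estimation weight `b i` and over-estimation
weight `h i`; the `n`-dimensional problem uses the coordinates `i < n`. -/
structure Model where
  b : ℕ → ℝ
  h : ℕ → ℝ
  σp : ℕ → ℝ
  σf : ℕ → ℝ
  b_pos : ∀ i, 0 < b i
  h_pos : ∀ i, 0 < h i
  σp_pos : ∀ i, 0 < σp i
  σf_pos : ∀ i, 0 < σf i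

/-- Standard normal density. -/
def stdPdf (w : ℝ) : ℝ := gaussianPDFReal 0 1 w

/-- Standard normal distribution function. -/
def stdCdf (w : ℝ) : ℝ := cdf (gaussianReal 0 1) w

/-- Standard normal quantile function, the inverse of `stdCdf` on `(0, 1)`. -/
def stdQuantile (p : ℝ) : ℝ := sInf {w : ℝ | p ≤ stdCdf w}

/-- `G(w, β) = φ(w) + w Φ(w) - β w`. -/
def G (w β : ℝ) : ℝ := stdPdf w + w * stdCdf w - β * w

/-- The rate `a_n = log log n`. -/
def rate (n : ℕ) : ℝ := Real.log (Real.log n)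

/-- `s^k H_k(u / s)` with `s = √v` and `H_k` the probabilists' Hermite polynomial; at `v = 0` it is
extended by continuity, i.e. it equals `u ^ k`. -/
def scaledHermite (v : ℝ) (k : ℕ) (u : ℝ) : ℝ :=
  if v = 0 then u ^ k
  else Real.sqrt v ^ k * Polynomial.aeval (u / Real.sqrt v) (Polynomial.hermite k)

/-- Threshold `λ_n(i) = γ(i) √(2 log n)` for the tuning constants `γ`. -/
def threshold (γ : ℕ → ℝ) (n i : ℕ) : ℝ := γ i * Real.sqrt (2 * Real.log n)

namespace Model

variable (M : Model)

/-- Critical ratio `b_i / (b_i + h_i)`. -/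
def ratio (i : ℕ) : ℝ := M.b i / (M.b i + M.h i)

/-- Law of the past data `X ∼ N(θ, Σ_p)` in dimension `n`: independent `X_i ∼ N(θ_i, σ_{p,i})`. -/
def pastLaw (θ : ℕ → ℝ) (n : ℕ) : Measure (Fin n → ℝ) :=
  Measure.pi fun i : Fin n => gaussianReal (θ i) (M.σp i).toNNReal

/-- Predictive loss of coordinate `i`: the expected check loss of predicting the future
`Y_i ∼ N(t, σ_{f,i})` by `q`. -/
def coordLoss (i : ℕ) (t q : ℝ) : ℝ :=
  ∫ y, (M.b i * max (y - q) 0 + M.h i * max (q - y) 0) ∂(gaussianReal t (M.σf i).toNNReal)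

/-- Cumulative loss `L_n(θ, q)`. -/
def loss (n : ℕ) (θ : ℕ → ℝ) (q : Fin n → ℝ) : ℝ :=
  (1 / (n : ℝ)) * ∑ i : Fin n, M.coordLoss i (θ i) (q i)

/-- Shrinkage factor `α_i(τ) = τ / (τ + σ_{p,i})`, with `α_i(∞) = 1`. -/
def shrink (i : ℕ) (τ : ℝ≥0∞) : ℝ :=
  if τ = ∞ then 1 else τ.toReal / (τ.toReal + M.σp i)

/-- The origin-centric shrinkage predictor `q̂(τ)` computed from past data `x`. -/
def predictor (n : ℕ) (τ : ℝ≥0∞) (x : Fin n → ℝ) (i : Fin n) : ℝ :=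
  M.shrink i τ * x i
    + Real.sqrt (M.σf i + M.shrink i τ * M.σp i) * stdQuantile (M.ratio i)

/-! ### The asymptotic risk estimate -/

/-- `c_i(τ)`. -/
def c (i : ℕ) (τ : ℝ≥0∞) : ℝ :=
  Real.sqrt ((M.σf i + M.shrink i τ * M.σp i) / (M.σf i + M.shrink i τ ^ 2 * M.σp i))
    * stdQuantile (M.ratio i)

/-- `d_i(τ)`. -/
def d (i : ℕ) (τ : ℝ≥0∞) : ℝ :=
  -((1 - M.shrink i τ) / Real.sqrt (M.σf i + M.σp i * M.shrink i τ ^ 2))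

/-- `U_i(τ) = c_i(τ) + d_i(τ) (x + √σ_{p,i} z)`. -/
def U (i : ℕ) (τ : ℝ≥0∞) (x z : ℝ) : ℝ := M.c i τ + M.d i τ * (x + Real.sqrt (M.σp i) * z)

/-- `V_i(τ) = c_i(τ) + d_i(τ) (x - √σ_{p,i} z)`. -/
def V (i : ℕ) (τ : ℝ≥0∞) (x z : ℝ) : ℝ := M.c i τ + M.d i τ * (x - Real.sqrt (M.σp i) * z)

/-- Truncation order `K_n(i)` for the tuning constants `γ`. -/
def K (γ : ℕ → ℝ) (n i : ℕ) : ℕ :=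
  1 + ⌈Real.exp 1 ^ 2 * (γ i + Real.sqrt (2 * M.σp i / M.σf i)) ^ 2 * (2 * Real.log n)⌉₊

/-- `S_i(u)`, the unbiased estimate of the `K_n(i)`-th order Taylor polynomial of `G(·, b̃_i)`;
the summation index runs over `0 ≤ k ≤ K_n(i) - 2`. -/
def S (γ : ℕ → ℝ) (n i : ℕ) (τ : ℝ≥0∞) (u : ℝ) : ℝ :=
  G 0 (M.ratio i) + deriv (fun w => G w (M.ratio i)) 0 * u
    + stdPdf 0 * ∑ k ∈ Finset.range (M.K γ n i - 1),
        ((-1) ^ k * Polynomial.aeval (0 : ℝ) (Polynomial.hermite k) / ((k + 2).factorial : ℝ))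
          * scaledHermite (2 * M.σp i * M.d i τ ^ 2) (k + 2) u

/-- `S̃_i(u)`: `S_i(u)` truncated to `[-n, n]`. -/
def Strunc (γ : ℕ → ℝ) (n i : ℕ) (τ : ℝ≥0∞) (u : ℝ) : ℝ :=
  max (-(n : ℝ)) (min (n : ℝ) (M.S γ n i τ u))

/-- The randomized coordinatewise threshold estimate `T̂_i(x, z, τ)`. -/
def Trand (γ : ℕ → ℝ) (n i : ℕ) (τ : ℝ≥0∞) (x z : ℝ) : ℝ :=
  if M.V i τ x z < -threshold γ n i then -(M.ratio i) * M.U i τ x z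
  else if M.V i τ x z ≤ threshold γ n i then M.Strunc γ n i τ (M.U i τ x z)
  else (1 - M.ratio i) * M.U i τ x z

/-- The Rao-Blackwellized estimate `T̂_i(x, τ)`: expectation over the user-added noise
`Z_i ∼ N(0, 1)`. -/
def T (γ : ℕ → ℝ) (n i : ℕ) (τ : ℝ≥0∞) (x : ℝ) : ℝ :=
  ∫ z, M.Trand γ n i τ x z ∂(gaussianReal 0 1)

/-- The asymptotic risk estimate `ARE_n(τ)` computed from past data `x`. -/
def ARE (γ : ℕ → ℝ) (n : ℕ) (x : Fin n → ℝ) (τ : ℝ≥0∞) : ℝ :=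
  (1 / (n : ℝ)) * ∑ i : Fin n,
    (M.b i + M.h i) * Real.sqrt (M.σf i + M.σp i * M.shrink i τ ^ 2) * M.T γ n i τ (x i)

/-! ### Assumptions -/

/-- A1: the critical ratios are bounded away from `0` and `1`, and the weights are bounded. -/
def AssumptionA1 : Prop :=
  (∃ l > 0, ∀ i, l ≤ M.ratio i) ∧ (∃ u < 1, ∀ i, M.ratio i ≤ u) ∧ ∃ B, ∀ i, M.b i + M.h i ≤ B

/-- A3: `sup σ_{p,i} / σ_{f,i} < 1 / (4e)`, `sup σ_{f,i} < ∞` and `inf σ_{p,i} > 0`. -/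
def AssumptionA3 : Prop :=
  (∃ ρ < 1 / (4 * Real.exp 1), ∀ i, M.σp i / M.σf i ≤ ρ) ∧ (∃ s, ∀ i, M.σf i ≤ s) ∧
    ∃ s > 0, ∀ i, s ≤ M.σp i

/-- Admissible tuning constants: `0 < γ(i) < 1/√(4e) - √(σ_{p,i}/σ_{f,i})`, with a positive lower
bound that is uniform in `i`. -/
def AdmissibleTuning (γ : ℕ → ℝ) : Prop :=
  (∃ g > 0, ∀ i, g ≤ γ i) ∧
    ∀ i, γ i < 1 / Real.sqrt (4 * Real.exp 1) - Real.sqrt (M.σp i / M.σf i)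

/-- Admissible constants `C₁, …, C₄` for the construction of the grid. -/
def AdmissibleConstants (θ : ℕ → ℝ) (C₁ C₂ C₃ C₄ : ℝ) : Prop :=
  (∀ i, M.b i + M.h i ≤ C₁) ∧ (∀ i, max (M.σp i) (M.σp i)⁻¹ ≤ C₂) ∧
    (∀ i j, M.σp i / M.σf i * |stdQuantile (M.ratio j)| ≤ C₃) ∧
    ∀ᶠ n : ℕ in atTop, (1 / (n : ℝ)) * ∑ i ∈ Finset.range n, |θ i| ≤ C₄ * Real.sqrt (rate n)

end Model

/-- A2: `limsup (1/n) ∑_{i < n} |θ_i| < ∞`. -/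
def AssumptionA2 (θ : ℕ → ℝ) : Prop :=
  ∃ B, ∀ᶠ n : ℕ in atTop, (1 / (n : ℝ)) * ∑ i ∈ Finset.range n, |θ i| ≤ B

/-- Mesh size `δ_n` of the grid. -/
def mesh (C₁ C₂ C₃ C₄ : ℝ) (n : ℕ) : ℝ :=
  (2 * C₁ * C₂ * (2 * stdPdf 0 + C₃ + Real.sqrt (rate n) * C₄ + rate n))⁻¹

/-- The grid `Λ_n ⊆ [0, ∞]`: the points `τ = t / (1 - t)` with
`t = 0, δ_n, 2 δ_n, …, (⌈1/δ_n⌉ - 1) δ_n`. -/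
def grid (C₁ C₂ C₃ C₄ : ℝ) (n : ℕ) : Set ℝ≥0∞ :=
  (fun j : ℕ => ENNReal.ofReal (j * mesh C₁ C₂ C₃ C₄ n)
      / ENNReal.ofReal (1 - j * mesh C₁ C₂ C₃ C₄ n)) '' {j | j < ⌈1 / mesh C₁ C₂ C₃ C₄ n⌉₊}

/-! ### The minimizers over `[0, ∞]` and over the grid exist -/

namespace Model

variable (M : Model)

theorem continuous_shrink (i : ℕ) : Continuous (M.shrink i) := by
  have hs := M.σp_pos i
  have h : M.shrink i = fun τ : ℝ≥0∞ => ((1 + ENNReal.ofReal (M.σp i) / τ)⁻¹).toReal := by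
    funext τ
    unfold shrink
    split_ifs with ht
    · simp [ht]
    · by_cases h0 : τ = 0
      · subst h0
        rw [ENNReal.div_zero (by simpa using hs)]
        simp
      · have hp : 0 < τ.toReal := ENNReal.toReal_pos h0 ht
        rw [ENNReal.toReal_inv, ENNReal.toReal_add (by simp)
          (ENNReal.div_ne_top (by simp) h0), ENNReal.toReal_div, ENNReal.toReal_ofReal hs.le]
        simp
        field_simp
  rw [h]
  have hc : Continuous (fun τ : ℝ≥0∞ => (1 + ENNReal.ofReal (M.σp i) / τ)⁻¹) := by
    simp_rw [div_eq_mul_inv]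
    have : Continuous fun τ : ℝ≥0∞ => ENNReal.ofReal (M.σp i) * τ⁻¹ :=
      ENNReal.continuous_const_mul (by simp) |>.comp continuous_inv
    exact (continuous_const.add this).inv
  refine ENNReal.continuousOn_toReal.comp_continuous hc fun τ => ?_
  simp

theorem continuous_coordLoss (i : ℕ) (t : ℝ) : Continuous (M.coordLoss i t) := by
  have hb := M.b_pos i
  have hh := M.h_pos i
  set μ := gaussianReal t (M.σf i).toNNReal
  have hid : Integrable (fun y : ℝ => y) μ := 
    (memLp_id_gaussianReal (μ := t) (v := (M.σf i).toNNReal) 1).integrable le_rfl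
  refine continuous_iff_continuousAt.2 fun q₀ => ?_
  refine continuousAt_of_dominated (bound := fun y => (M.b i + M.h i) * (|y| + (|q₀| + 1))) ?_ ?_ ?_ ?_
  · exact Eventually.of_forall fun q => by fun_prop
  · have : ∀ᶠ q in 𝓝 q₀, |q| < |q₀| + 1 :=
      (continuous_abs.tendsto q₀).eventually_lt_const (by linarith)
    filter_upwards [this] with q hq
    refine Eventually.of_forall fun y => ?_
    have h1 : max (y - q) 0 ≤ |y| + (|q₀| + 1) := by
      apply max_le _ (by positivity)
      have := le_abs_self y; have := neg_abs_le q; linarith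
    have h2 : max (q - y) 0 ≤ |y| + (|q₀| + 1) := by
      apply max_le _ (by positivity)
      have := neg_abs_le y; have := le_abs_self q; linarith
    rw [Real.norm_of_nonneg (by positivity)]
    nlinarith
  · exact (hid.abs.add (integrable_const _)).const_mul _
  · exact Eventually.of_forall fun y => by fun_prop

theorem exists_oracle (n : ℕ) (θ : ℕ → ℝ) (x : Fin n → ℝ) :
    ∃ τ₀ : ℝ≥0∞, ∀ τ : ℝ≥0∞,
      M.loss n θ (M.predictor n τ₀ x) ≤ M.loss n θ (M.predictor n τ x) := by
  have hc : Continuous fun τ : ℝ≥0∞ => M.loss n θ (M.predictor n τ x) := by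
    unfold loss predictor
    refine continuous_const.mul (continuous_finsetSum _ fun i _ => ?_)
    refine (M.continuous_coordLoss i (θ i)).comp ?_
    have := M.continuous_shrink i
    fun_prop
  obtain ⟨τ₀, -, h⟩ := isCompact_univ.exists_isMinOn (Set.univ_nonempty) hc.continuousOn
  exact ⟨τ₀, fun τ => h (Set.mem_univ τ)⟩

end Model

theorem mesh_pos (M : Model) (θ : ℕ → ℝ) (C₁ C₂ C₃ C₄ : ℝ)
    (hC : M.AdmissibleConstants θ C₁ C₂ C₃ C₄) (n : ℕ) : 0 < mesh C₁ C₂ C₃ C₄ n := by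
  obtain ⟨h1, h2, h3, h4⟩ := hC
  have hC1 : 0 < C₁ := lt_of_lt_of_le (add_pos (M.b_pos 0) (M.h_pos 0)) (h1 0)
  have hC2 : 0 < C₂ := lt_of_lt_of_le (lt_max_of_lt_left (M.σp_pos 0)) (h2 0)
  have hC3 : 0 ≤ C₃ := le_trans
    (mul_nonneg (div_pos (M.σp_pos 0) (M.σf_pos 0)).le (abs_nonneg _)) (h3 0 0)
  have hC4 : 0 ≤ C₄ := by
    have hr : ∀ᶠ k : ℕ in atTop, 0 < rate k :=
      (Real.tendsto_log_atTop.comp (Real.tendsto_log_atTop.comp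
        tendsto_natCast_atTop_atTop)).eventually_gt_atTop 0
    obtain ⟨k, hk, hk'⟩ := (h4.and hr).exists
    have h0 : 0 ≤ (1 / (k : ℝ)) * ∑ i ∈ Finset.range k, |θ i| :=
      mul_nonneg (by positivity) (Finset.sum_nonneg fun _ _ => abs_nonneg _)
    exact nonneg_of_mul_nonneg_left (h0.trans hk) (Real.sqrt_pos.2 hk')
  have hφ : 1 / 3 < stdPdf 0 := by
    have hs : Real.sqrt (2 * Real.pi) < 3 := by
      rw [Real.sqrt_lt' (by norm_num)]
      nlinarith [Real.pi_lt_four]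
    have h0 : 0 < Real.sqrt (2 * Real.pi) := Real.sqrt_pos.2 (by positivity)
    simp only [stdPdf, gaussianPDFReal, NNReal.coe_one, mul_one, sub_zero]
    rw [show -(0 : ℝ) ^ 2 / 2 = 0 by norm_num, Real.exp_zero, mul_one, ← one_div]
    exact one_div_lt_one_div_of_lt h0 hs
  have hr : -(1 / 2) < rate n := by
    rcases Nat.lt_or_ge n 2 with hn | hn
    · interval_cases n <;> norm_num [rate]
    · have hl : 0.69 < Real.log n :=
        lt_of_lt_of_le (b := Real.log 2) (by linarith [Real.log_two_gt_d9])
          (Real.log_le_log (by norm_num) (by exact_mod_cast hn))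
      have hb : (Real.log n)⁻¹ < 0.69⁻¹ := inv_strictAnti₀ (by norm_num) hl
      have := Real.one_sub_inv_le_log_of_pos (show 0 < Real.log n by linarith)
      unfold rate
      norm_num at hb
      linarith
  have : 0 ≤ Real.sqrt (rate n) * C₄ := mul_nonneg (Real.sqrt_nonneg _) hC4
  exact inv_pos.2 (mul_pos (by positivity) (by linarith))

theorem exists_grid_minimizer (M : Model) (θ γ : ℕ → ℝ) (C₁ C₂ C₃ C₄ : ℝ)
    (hC : M.AdmissibleConstants θ C₁ C₂ C₃ C₄) (n : ℕ) (x : Fin n → ℝ) :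
    ∃ τ₀ ∈ grid C₁ C₂ C₃ C₄ n, ∀ τ ∈ grid C₁ C₂ C₃ C₄ n, M.ARE γ n x τ₀ ≤ M.ARE γ n x τ := by
  refine Set.exists_min_image _ _ ((Set.finite_lt_nat _).image _) ?_
  exact ⟨_, 0, Nat.ceil_pos.2 (one_div_pos.2 (mesh_pos M θ C₁ C₂ C₃ C₄ hC n)), rfl⟩

end

end CheckLoss

namespace CheckLoss

noncomputable section

/-! Averaging the loss of coordinate i over X_i gives weight · G(m, b̃_i) with m = c_i(τ) +
d_i(τ)θ_i (`integral_coordLoss`), so the task is to estimate G(m, β) well enough that the average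
over coordinates concentrates at every grid point.

Adding and subtracting noise of the variance of X_i turns one observation into two independent N(m,
v) variables U and V (`map_add_sub_gaussianReal`): V chooses the estimate, U evaluates it. With N
standard normal, G(m, β) differs from (1-β)m by E(N-m)^+ and from -βm by E(m-N)^+. A linear estimate
is bad only when m is not far out on its own side of zero, and then V rarely selects it; each side
costs a bias of at most 2/λ. For the middle piece let t₀ = √(2 log n) and s = √(2σ_p/σ_f), so that v
≤ s². If |m| ≥ (γ+s)t₀, then V lies in [-λ, λ] with probability at most 1/(n t₀), which offsets the
truncation at n (`middle_far`). If |m| ≤ (γ+s)t₀, the order K_n makes the Taylor remainder of G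
small, while the Hermite estimate has second moment at most polylog(n) · exp(2m²) (`middle_near`).
The tuning condition gives (γ+s)² ≤ 1/(2e), hence exp(2m²) ≤ n^{2/e}, which is o(n). In all cases
the bias is O(1/√log n) and the mean squared error is O(n/√log n), uniformly in i, τ and θ_i
(`thresholdEst_bounds`); averaging over Z does not increase them.

Chebyshev's inequality then bounds the probability that estimate and loss differ by ε/3 at one grid
point by O(1/√log n). The grid has O(log log n) points, so a union bound covers the random
minimizer. Finally, the loss is Lipschitz in the shrinkage factors, and these are Lipschitz in t =
τ/(1+τ), so some grid point loses only O(δ_n) against the oracle; Markov's inequality for the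
average of |X_i| makes this precise. -/

/-! ### Gaussian integrals of polynomials -/

open Polynomial in
theorem integrable_eval_gaussianReal (μ : ℝ) (v : ℝ≥0) (p : ℝ[X]) :
    Integrable (fun x => p.eval x) (gaussianReal μ v) := by
  induction p using Polynomial.induction_on' with
  | add p q hp hq => exact (hp.add hq).congr (ae_of_all _ fun x => by simp)
  | monomial n a =>
    simp only [eval_monomial]
    refine Integrable.const_mul ?_ a
    have h : MemLp id (n : ℝ≥0∞) (gaussianReal μ v) := memLp_id_gaussianReal (n : ℝ≥0)
    rcases Nat.eq_zero_or_pos n with rfl | hn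
    · simp
    · exact (integrable_norm_iff (by fun_prop)).1
        ((h.integrable_norm_pow hn.ne').congr (ae_of_all _ fun x => by simp))

theorem hasDerivAt_stdPdf (x : ℝ) : HasDerivAt stdPdf (-x * stdPdf x) x := by
  have h : stdPdf = fun x => (Real.sqrt (2 * Real.pi))⁻¹ * Real.exp (-x ^ 2 / 2) := by
    funext x; simp [stdPdf, gaussianPDFReal]
  rw [h]
  have h1 : HasDerivAt (fun x : ℝ => -x ^ 2 / 2) (-x) x := by
    exact (((hasDerivAt_pow 2 x).neg).div_const 2).congr_deriv (by norm_num; ring)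
  exact ((h1.exp).const_mul (Real.sqrt (2 * Real.pi))⁻¹).congr_deriv (by ring)

theorem integrable_stdPdf_mul_iff {f : ℝ → ℝ} :
    Integrable (fun x => stdPdf x * f x) ↔ Integrable f (gaussianReal 0 1) := by
  rw [gaussianReal_of_var_ne_zero _ one_ne_zero, gaussianPDF_def,
    integrable_withDensity_iff_integrable_smul' (by fun_prop) (by simp)]
  simp [stdPdf, gaussianPDFReal_nonneg, smul_eq_mul]

theorem integral_std (f : ℝ → ℝ) : ∫ x, f x ∂(gaussianReal 0 1) = ∫ x, stdPdf x * f x := by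
  rw [integral_gaussianReal_eq_integral_smul one_ne_zero]; rfl

open Polynomial in
/-- Gaussian integration by parts for polynomials. -/
theorem integral_mul_eval_std (p : ℝ[X]) :
    ∫ x, x * p.eval x ∂(gaussianReal 0 1) = ∫ x, (derivative p).eval x ∂(gaussianReal 0 1) := by
  have h1 : Integrable (fun x => x * p.eval x) (gaussianReal 0 1) := by
    exact (integrable_eval_gaussianReal 0 1 (X * p)).congr (ae_of_all _ fun x => by simp)
  have h2 := integrable_eval_gaussianReal 0 1 (derivative p)
  have key := integral_eq_zero_of_hasDerivAt_of_integrable (f := fun x => stdPdf x * p.eval x)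
    (f' := fun x => stdPdf x * (derivative p).eval x - stdPdf x * (x * p.eval x)) (fun x => by
      exact ((hasDerivAt_stdPdf x).mul (p.hasDerivAt x)).congr_deriv (by ring))
    ((integrable_stdPdf_mul_iff.2 h2).sub (integrable_stdPdf_mul_iff.2 h1))
    (integrable_stdPdf_mul_iff.2 (integrable_eval_gaussianReal 0 1 p))
  rw [integral_sub (integrable_stdPdf_mul_iff.2 h2) (integrable_stdPdf_mul_iff.2 h1)] at key
  rw [integral_std, integral_std]
  linarith

theorem gaussianReal_eq_map (m s : ℝ) (v : ℝ≥0) (hs : s ^ 2 = v) :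
    gaussianReal m v = (gaussianReal 0 1).map (fun x => m + s * x) := by
  have h := gaussianReal_map_const_mul (μ := 0) (v := 1) s
  have h2 := gaussianReal_map_const_add (μ := 0) (v := v) m
  rw [← show (fun x => m + x) ∘ (fun x => s * x) = fun x => m + s * x from rfl,
    ← Measure.map_map (by fun_prop) (by fun_prop), h]
  have : (NNReal.mk (s ^ 2) (sq_nonneg s) * 1 : ℝ≥0) = v := by
    rw [mul_one]; exact NNReal.eq hs
  rw [this, mul_zero, h2, zero_add]

theorem integral_gaussianReal_eq_std (m s : ℝ) (v : ℝ≥0) (hs : s ^ 2 = v) {f : ℝ → ℝ}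
    (hf : Measurable f) :
    ∫ x, f x ∂(gaussianReal m v) = ∫ x, f (m + s * x) ∂(gaussianReal 0 1) := by
  rw [gaussianReal_eq_map m s v hs, integral_map (by fun_prop) hf.aestronglyMeasurable]

-- Stein's identity for a general mean and variance, by the substitution x = m + s y from the
-- standard case; it also holds for the point mass v = 0.
open Polynomial in
theorem integral_sub_mul_eval_gaussianReal (m : ℝ) (v : ℝ≥0) (p : ℝ[X]) :
    ∫ x, (x - m) * p.eval x ∂(gaussianReal m v)
      = v * ∫ x, (derivative p).eval x ∂(gaussianReal m v) := by
  have hs : Real.sqrt v ^ 2 = v := Real.sq_sqrt v.2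
  rw [integral_gaussianReal_eq_std m _ v hs (by fun_prop),
    integral_gaussianReal_eq_std m _ v hs (by fun_prop)]
  set s := Real.sqrt v
  have h := integral_mul_eval_std (p.comp (C m + C s * X))
  simp only [eval_comp, derivative_comp, derivative_add, derivative_C, derivative_C_mul, derivative_X,
    eval_add, eval_mul, eval_C, eval_X, mul_one, zero_add] at h
  calc _ = ∫ x, s * (x * eval (m + s * x) p) ∂(gaussianReal 0 1) := by
        congr 1; funext x; ring
    _ = _ := by rw [integral_const_mul, h, integral_const_mul, ← mul_assoc, ← hs]; ring

/-! ### Hermite polynomials of variance v -/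

open Polynomial in
/-- Hermite polynomials of variance `v`. -/
def hermiteVar (v : ℝ) : ℕ → ℝ[X]
  | 0 => 1
  | k + 1 => X * hermiteVar v k - C v * derivative (hermiteVar v k)

-- Differentiating the induction hypothesis produces exactly one factor s, which is what the
-- recursion needs to turn variance s² into variance 1.
open Polynomial in
theorem hermiteVar_comp (s : ℝ) (k : ℕ) :
    (hermiteVar (s ^ 2) k).comp (C s * X) = C (s ^ k) * (hermite k).map (Int.castRingHom ℝ) := by
  induction k with
  | zero => simp [hermiteVar]
  | succ k ih =>
    have hd : C s * (derivative (hermiteVar (s ^ 2) k)).comp (C s * X)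
        = C (s ^ k) * derivative ((hermite k).map (Int.castRingHom ℝ)) := by
      have := congrArg derivative ih
      simpa only [derivative_comp, derivative_C_mul, derivative_X, mul_one] using this
    simp only [hermiteVar, sub_comp, mul_comp, X_comp, C_comp, hermite_succ, Polynomial.map_sub,
      Polynomial.map_mul, map_X, ih, ← derivative_map]
    have : C (s ^ 2) * (derivative (hermiteVar (s ^ 2) k)).comp (C s * X)
      = C s * (C (s ^ k) * derivative ((hermite k).map (Int.castRingHom ℝ))) := by
      rw [← hd, ← mul_assoc, ← C_mul]; ring_nf
    rw [this, pow_succ, C_mul]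
    ring

-- The recursive family is polynomial in v and needs no division by √v, so it absorbs the case v =
-- 0, which occurs at τ = ∞.
open Polynomial in
theorem scaledHermite_eq (v : ℝ) (hv : 0 ≤ v) (k : ℕ) (u : ℝ) :
    scaledHermite v k u = (hermiteVar v k).eval u := by
  unfold scaledHermite
  split_ifs with h0
  · subst h0
    induction k with
    | zero => simp [hermiteVar]
    | succ k ih => simp [hermiteVar, ← ih]; ring
  · have hs : 0 < Real.sqrt v := Real.sqrt_pos.2 (lt_of_le_of_ne hv (Ne.symm h0))
    have h := congrArg (Polynomial.eval (u / Real.sqrt v)) (hermiteVar_comp (Real.sqrt v) k)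
    rw [Real.sq_sqrt hv] at h
    simp only [eval_comp, eval_mul, eval_C, eval_X, mul_div_cancel₀ _ hs.ne'] at h
    rw [h, aeval_def, eval_map]; rfl

open Polynomial in
theorem derivative_hermiteVar_succ (v : ℝ) (k : ℕ) :
    derivative (hermiteVar v (k + 1)) = C ((k : ℝ) + 1) * hermiteVar v k := by
  induction k with
  | zero => simp [hermiteVar]
  | succ k ih =>
    have e : ∀ j, hermiteVar v (j + 1) = X * hermiteVar v j - C v * derivative (hermiteVar v j) :=
      fun _ => rfl
    rw [e (k + 1), derivative_sub, derivative_mul, derivative_C_mul, ih, derivative_X,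
      derivative_C_mul, e k]
    simp; ring

/-- Stein's identity applied to He_k · p: the term with the derivative of He_k is the one subtracted
in the recursion for He_{k+1}, so it cancels. -/
theorem integral_hermiteVar_succ_mul (m : ℝ) (v : ℝ≥0) (k : ℕ) (p : Polynomial ℝ) :
    ∫ x, (hermiteVar v (k + 1)).eval x * p.eval x ∂(gaussianReal m v)
      = m * ∫ x, (hermiteVar v k).eval x * p.eval x ∂(gaussianReal m v)
        + v * ∫ x, (hermiteVar v k).eval x * (Polynomial.derivative p).eval x
            ∂(gaussianReal m v) := by
  have h := integral_sub_mul_eval_gaussianReal m v (hermiteVar v k * p)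
  have i : ∀ q r : Polynomial ℝ, Integrable (fun x => q.eval x * r.eval x) (gaussianReal m v) :=
    fun q r => (integrable_eval_gaussianReal m v (q * r)).congr (ae_of_all _ fun x => by simp)
  have i2 : Integrable (fun x => (x - m) * ((hermiteVar v k).eval x * p.eval x))
      (gaussianReal m v) := by
    exact (integrable_eval_gaussianReal m v
      ((Polynomial.X - Polynomial.C m) * (hermiteVar v k * p))).congr (ae_of_all _ fun x => by simp)
  simp only [Polynomial.eval_mul, Polynomial.derivative_mul, Polynomial.eval_add] at h
  rw [integral_add (i _ _) (i _ _)] at h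
  calc _ = ∫ x, ((x - m) * ((hermiteVar v k).eval x * p.eval x)
          + m * ((hermiteVar v k).eval x * p.eval x))
          - v * ((Polynomial.derivative (hermiteVar v k)).eval x * p.eval x) ∂(gaussianReal m v) := by
        congr 1; funext x; simp [hermiteVar]; ring
    _ = _ := by
        rw [integral_sub (by exact i2.add ((i _ _).const_mul _)) ((i _ _).const_mul _),
          integral_add i2 ((i _ _).const_mul _), h, integral_const_mul, integral_const_mul]
        ring

theorem integral_hermiteVar (m : ℝ) (v : ℝ≥0) (k : ℕ) :
    ∫ x, (hermiteVar v k).eval x ∂(gaussianReal m v) = m ^ k := by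
  induction k with
  | zero => simp [hermiteVar]
  | succ k ih =>
    have h := integral_hermiteVar_succ_mul m v k 1
    simp only [Polynomial.eval_one, mul_one, Polynomial.derivative_one, Polynomial.eval_zero,
      mul_zero, integral_zero, add_zero, ih] at h
    rw [h]; ring

/-- The mean is m rather than 0, so orthogonality is replaced by a sum over the number j of
contracted pairs. For j > l the truncated exponent l - j is harmless because the binomial
coefficient vanishes. -/
theorem integral_hermiteVar_mul (m : ℝ) (v : ℝ≥0) (k l : ℕ) :
    ∫ x, (hermiteVar v k).eval x * (hermiteVar v l).eval x ∂(gaussianReal m v)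
      = ∑ j ∈ Finset.range (k + 1),
          (k.choose j * l.choose j * j.factorial : ℝ) * v ^ j * (m ^ (k - j) * m ^ (l - j)) := by
  induction k generalizing l with
  | zero => simp [hermiteVar, integral_hermiteVar]
  | succ k ih =>
    rw [integral_hermiteVar_succ_mul, ih]
    -- Pascal's rule for the first binomial: one part matches the term with factor m, the other,
    -- after a shift of j, the term with factor v.
    have e : ∀ j ∈ Finset.range (k + 1 + 1),
        ((k + 1).choose j * l.choose j * j.factorial : ℝ) * v ^ j
          * (m ^ (k + 1 - j) * m ^ (l - j))
        = (k.choose j * l.choose j * j.factorial : ℝ) * v ^ j * (m ^ (k + 1 - j) * m ^ (l - j))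
        + (if j = 0 then 0 else (k.choose (j - 1) * l.choose j * j.factorial : ℝ) * v ^ j
            * (m ^ (k + 1 - j) * m ^ (l - j))) := by
      intro j _
      cases j with
      | zero => simp
      | succ j => rw [Nat.choose_succ_succ]; push_cast; simp; ring
    rw [Finset.sum_congr rfl e, Finset.sum_add_distrib]
    congr 1
    · rw [Finset.sum_range_succ _ (k + 1), Nat.choose_succ_self, Finset.mul_sum]
      simp only [Nat.cast_zero, zero_mul, add_zero]
      refine Finset.sum_congr rfl fun j hj => ?_
      rw [Nat.succ_sub (by simpa [Nat.lt_succ_iff] using hj), pow_succ]; ring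
    · rw [Finset.sum_range_succ']
      simp only [if_true, add_zero, Nat.succ_ne_zero, if_false, Nat.add_sub_cancel,
        Nat.add_sub_add_right]
      cases l with
      | zero => simp [hermiteVar]
      | succ l =>
        simp only [derivative_hermiteVar_succ, Polynomial.eval_mul, Polynomial.eval_C]
        calc _ = (v : ℝ) * (((l : ℝ) + 1) * ∫ x, (hermiteVar v k).eval x * (hermiteVar v l).eval x
                  ∂(gaussianReal m v)) := by
              rw [← integral_const_mul ((l : ℝ) + 1)]; congr 2; ext x; ring
          _ = _ := by
              rw [ih, Finset.mul_sum, Finset.mul_sum]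
              refine Finset.sum_congr rfl fun j _ => ?_
              have := Nat.add_one_mul_choose_eq l j
              have h' : ((l : ℝ) + 1) * l.choose j = (l + 1).choose (j + 1) * (j + 1) := by
                exact_mod_cast this
              rw [Nat.factorial_succ, Nat.add_sub_add_right]
              push_cast
              calc _ = (k.choose j : ℝ) * (((l : ℝ) + 1) * l.choose j) * j.factorial * v ^ (j + 1)
                    * (m ^ (k - j) * m ^ (l - j)) := by ring
                _ = _ := by rw [h']; ring

/-- Bound m^{2(k-j)} by 2^{-(k-j)} (k-j)! exp(2m²). The factorials combine to k!, and with v ≤ 1/2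
what is left is the binomial expansion of (1/2 + 1/2)^k = 1. -/
theorem integral_hermiteVar_sq_le (m : ℝ) (v : ℝ≥0) (hv : v ≤ 1 / 2) (k : ℕ) :
    ∫ x, (hermiteVar v k).eval x ^ 2 ∂(gaussianReal m v)
      ≤ k.factorial * Real.exp (2 * m ^ 2) := by
  have hv' : (v : ℝ) ≤ 1 / 2 := by exact_mod_cast hv
  simp only [sq ((hermiteVar v k).eval _)]
  rw [integral_hermiteVar_mul]
  have h1 : ∀ j ∈ Finset.range (k + 1),
      (k.choose j * k.choose j * j.factorial : ℝ) * v ^ j * (m ^ (k - j) * m ^ (k - j))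
      ≤ k.factorial * Real.exp (2 * m ^ 2) * ((1 / 2 : ℝ) ^ j * (1 / 2) ^ (k - j) * k.choose j) := by
    intro j hj
    have hjk : j ≤ k := by simpa [Nat.lt_succ_iff] using hj
    have hc : (k.choose j * j.factorial * (k - j).factorial : ℝ) = k.factorial := by
      exact_mod_cast Nat.choose_mul_factorial_mul_factorial hjk
    have hf : (0 : ℝ) < (k - j).factorial := by positivity
    have he := Real.pow_div_factorial_le_exp (2 * m ^ 2) (by positivity) (k - j)
    have hmm : m ^ (k - j) * m ^ (k - j)
        = (1 / 2) ^ (k - j) * ((2 * m ^ 2) ^ (k - j) / (k - j).factorial) * (k - j).factorial := by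
      rw [mul_pow, ← mul_pow m m]; field_simp; rw [← mul_pow, ← mul_pow]; ring_nf
    rw [hmm]
    calc _ = (k.choose j * j.factorial * (k - j).factorial : ℝ) * k.choose j * v ^ j
          * ((1 / 2) ^ (k - j) * ((2 * m ^ 2) ^ (k - j) / (k - j).factorial)) := by ring
      _ ≤ (k.choose j * j.factorial * (k - j).factorial : ℝ) * k.choose j * (1 / 2) ^ j
          * ((1 / 2) ^ (k - j) * Real.exp (2 * m ^ 2)) := by gcongr
      _ = _ := by rw [hc]; ring
  refine (Finset.sum_le_sum h1).trans ?_
  rw [← Finset.mul_sum, ← add_pow]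
  norm_num

/-! ### Normal density, distribution function and expected positive part -/

theorem continuous_stdPdf : Continuous stdPdf :=
  continuous_iff_continuousAt.2 fun x => (hasDerivAt_stdPdf x).continuousAt

theorem stdPdf_eq (x : ℝ) : stdPdf x = stdPdf 0 * Real.exp (-x ^ 2 / 2) := by
  simp [stdPdf, gaussianPDFReal]

theorem stdPdf_nonneg (x : ℝ) : 0 ≤ stdPdf x := gaussianPDFReal_nonneg _ _ _

theorem stdPdf_zero_le_one : stdPdf 0 ≤ 1 := by
  have h1 : 1 ≤ Real.sqrt (2 * Real.pi) := Real.one_le_sqrt.2 (by linarith [Real.pi_gt_three])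
  simpa [stdPdf, gaussianPDFReal] using inv_le_one_of_one_le₀ h1

theorem stdPdf_neg (x : ℝ) : stdPdf (-x) = stdPdf x := by
  rw [stdPdf_eq, stdPdf_eq x]; simp

theorem integrable_stdPdf : Integrable stdPdf := integrable_gaussianPDFReal 0 1

theorem stdCdf_eq_integral (w : ℝ) : stdCdf w = ∫ x in Set.Iic w, stdPdf x := by
  rw [stdCdf, cdf_eq_real, Measure.real, gaussianReal_apply_eq_integral _ one_ne_zero,
    ENNReal.toReal_ofReal (integral_nonneg fun x => gaussianPDFReal_nonneg _ _ _)]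
  rfl

theorem hasDerivAt_stdCdf (w : ℝ) : HasDerivAt stdCdf (stdPdf w) w := by
  have h : stdCdf = fun w => stdCdf 0 + ∫ x in (0 : ℝ)..w, stdPdf x := by
    funext w
    rw [← intervalIntegral.integral_Iic_sub_Iic integrable_stdPdf.integrableOn
      integrable_stdPdf.integrableOn, ← stdCdf_eq_integral, ← stdCdf_eq_integral]
    ring
  rw [h]
  exact (continuous_stdPdf.integral_hasStrictDerivAt 0 w).hasDerivAt.const_add _

theorem stdCdf_nonneg (w : ℝ) : 0 ≤ stdCdf w := cdf_nonneg _ _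

theorem stdCdf_le_one (w : ℝ) : stdCdf w ≤ 1 := cdf_le_one _ _

theorem tendsto_stdPdf_atBot : Tendsto stdPdf atBot (𝓝 0) := by
  have h : Tendsto (fun x : ℝ => -x ^ 2 / 2) atBot atBot := by
    have h1 : Tendsto (fun x : ℝ => x ^ 2) atBot atTop := by
      exact ((tendsto_pow_atTop (α := ℝ) two_ne_zero).comp tendsto_abs_atBot_atTop).congr
        fun x => sq_abs x
    exact Tendsto.atBot_div_const (by norm_num : (0 : ℝ) < 2) (tendsto_neg_atTop_atBot.comp h1)
  have h2 := (Real.tendsto_exp_atBot.comp h).const_mul (stdPdf 0)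
  rw [mul_zero] at h2
  exact h2.congr fun x => (stdPdf_eq x).symm

/-- The expected positive part `φ(w) + w Φ(w)` of `w - N`. -/
def expPos (w : ℝ) : ℝ := stdPdf w + w * stdCdf w

theorem G_eq (w β : ℝ) : G w β = expPos w - β * w := rfl

theorem hasDerivAt_expPos (w : ℝ) : HasDerivAt expPos (stdCdf w) w :=
  ((hasDerivAt_stdPdf w).add ((hasDerivAt_id w).mul (hasDerivAt_stdCdf w))).congr_deriv
    (by simp)

theorem integrable_max_sub (w m : ℝ) (v : ℝ≥0) :
    Integrable (fun x => max (w - x) 0) (gaussianReal m v) := by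
  have h : Integrable (fun x => w - x) (gaussianReal m v) :=
    (integrable_eval_gaussianReal m v (Polynomial.C w - Polynomial.X)).congr
      (ae_of_all _ fun x => by simp)
  exact h.pos_part

theorem integrable_pow_gaussianReal (m : ℝ) (v : ℝ≥0) (n : ℕ) :
    Integrable (fun x => x ^ n) (gaussianReal m v) :=
  (integrable_eval_gaussianReal m v (Polynomial.X ^ n)).congr (ae_of_all _ fun x => by simp)

theorem expPos_eq_integral (w : ℝ) : expPos w = ∫ x, max (w - x) 0 ∂(gaussianReal 0 1) := by
  have hi : Integrable (fun x => stdPdf x * (w - x)) := integrable_stdPdf_mul_iff.2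
    ((integrable_eval_gaussianReal 0 1 (Polynomial.C w - Polynomial.X)).congr
      (ae_of_all _ fun x => by simp))
  have h1 := integral_Iic_of_hasDerivAt_of_tendsto' (a := w) (m := 0)
    (f := fun x => w * stdCdf x + stdPdf x) (f' := fun x => stdPdf x * (w - x))
    (fun x _ => (((hasDerivAt_stdCdf x).const_mul w).add (hasDerivAt_stdPdf x)).congr_deriv
      (by ring)) hi.integrableOn (by
        have := (Tendsto.const_mul w (show Tendsto stdCdf atBot (𝓝 0) from
          tendsto_cdf_atBot (gaussianReal 0 1))).add tendsto_stdPdf_atBot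
        simpa only [mul_zero, add_zero] using this)
  have h2 : expPos w = w * stdCdf w + stdPdf w - 0 := by unfold expPos; ring
  rw [integral_std, h2, ← h1, ← integral_indicator measurableSet_Iic]
  congr 1; funext x
  by_cases hx : x ≤ w
  · simp [hx]
  · rw [Set.indicator_of_notMem (by simpa using hx), max_eq_right (by linarith), mul_zero]

theorem expPos_neg_eq_integral (w : ℝ) :
    expPos (-w) = ∫ x, max (x - w) 0 ∂(gaussianReal 0 1) := by
  rw [expPos_eq_integral]
  have h := gaussianReal_map_neg (μ := 0) (v := 1)
  rw [neg_zero] at h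
  nth_rewrite 2 [← h]
  rw [integral_map (by fun_prop) (by fun_prop)]
  congr 1; funext x; ring_nf

theorem expPos_nonneg (w : ℝ) : 0 ≤ expPos w := by
  rw [expPos_eq_integral]; exact integral_nonneg fun x => le_max_right _ _

/-- This makes both linear estimates errors of the same kind: G(w, β) exceeds -βw by `expPos w` and
(1-β)w by `expPos (-w)`. -/
theorem expPos_sub_neg (w : ℝ) : expPos w - expPos (-w) = w := by
  have h : Integrable (fun x : ℝ => x) (gaussianReal 0 1) := by
    simpa using integrable_pow_gaussianReal 0 1 1
  have hi : Integrable (fun x => max (x - w) 0) (gaussianReal 0 1) :=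
    (h.sub (integrable_const w)).pos_part
  rw [expPos_eq_integral w, expPos_neg_eq_integral, ← integral_sub (integrable_max_sub _ _ _) hi]
  have : ∀ x : ℝ, max (w - x) 0 - max (x - w) 0 = w - x := fun x => by
    rcases le_total w x with hx | hx
    · rw [max_eq_right (by linarith), max_eq_left (by linarith)]; ring
    · rw [max_eq_left (by linarith), max_eq_right (by linarith)]; ring
  simp_rw [this]
  rw [integral_sub (integrable_const _) h]
  simp

theorem integral_sq_std : ∫ x, x ^ 2 ∂(gaussianReal 0 1) = 1 := by
  have h := integral_mul_eval_std Polynomial.X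
  simp at h
  simpa [sq] using h

theorem expPos_le (w : ℝ) : expPos w ≤ 1 + |w| := by
  rw [expPos_eq_integral]
  have hi : Integrable (fun x => |w| + (1 / 2 + x ^ 2 / 2)) (gaussianReal 0 1) :=
    (integrable_const _).add ((integrable_const _).add ((integrable_pow_gaussianReal 0 1 2).div_const 2))
  refine (integral_mono (integrable_max_sub _ _ _) hi fun x => ?_).trans ?_
  · refine max_le ?_ (by positivity)
    have := le_abs_self w; nlinarith [sq_nonneg (x + 1)]
  · rw [integral_add (integrable_const _) (by
      exact (integrable_const _).add ((integrable_pow_gaussianReal 0 1 2).div_const 2)), integral_add (integrable_const _)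
      ((integrable_pow_gaussianReal 0 1 2).div_const 2), integral_div 2 (fun x : ℝ => x ^ 2), integral_sq_std]
    simp; linarith

/-- Pointwise (x-w)^+ ≤ x²/w, and the second moment is 1. The crude decay 1/w already gives a bias
of order 1/√log n. -/
theorem expPos_le_inv {w : ℝ} (hw : 0 < w) : expPos (-w) ≤ 1 / w := by
  rw [expPos_neg_eq_integral]
  have hi : Integrable (fun x => x ^ 2 / w) (gaussianReal 0 1) :=
    (integrable_pow_gaussianReal 0 1 2).div_const w
  have h : Integrable (fun x : ℝ => x) (gaussianReal 0 1) := by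
    simpa using integrable_pow_gaussianReal 0 1 1
  refine (integral_mono (h.sub (integrable_const w)).pos_part hi fun x => ?_).trans ?_
  · refine max_le ?_ (by positivity)
    rw [le_div_iff₀ hw]
    change (x - w) * w ≤ x ^ 2
    nlinarith [sq_nonneg (x - w / 2)]
  · rw [integral_div, integral_sq_std]

theorem abs_G_le (w : ℝ) {β : ℝ} (h0 : 0 ≤ β) (h1 : β ≤ 1) : |G w β| ≤ 1 + 2 * |w| := by
  rw [G_eq]
  have := expPos_nonneg w
  have := expPos_le w
  have h2 : |β * w| ≤ |w| := by
    rw [abs_mul, abs_of_nonneg h0]; exact mul_le_of_le_one_left (abs_nonneg _) h1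
  have := abs_sub (expPos w) (β * w)
  rw [abs_of_nonneg (expPos_nonneg w)] at this
  linarith

theorem deriv_G (w β : ℝ) : deriv (fun w => G w β) w = stdCdf w - β := by
  have h : HasDerivAt (fun w => expPos w - β * w) (stdCdf w - β) w :=
    ((hasDerivAt_expPos w).sub ((hasDerivAt_id w).const_mul β)).congr_deriv (by simp)
  exact h.deriv

/-! ### Gaussian tail bounds -/

/-- Mills' inequality. -/
theorem gaussianReal_Iic_neg_le {t : ℝ} (ht : 0 < t) :
    (gaussianReal 0 1).real (Set.Iic (-t)) ≤ Real.exp (-t ^ 2 / 2) / t := by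
  have h0 : (gaussianReal 0 1).real (Set.Iic (-t)) = stdCdf (-t) := by rw [stdCdf, cdf_eq_real]
  have hi : Integrable (fun x => -x * stdPdf x) := by
    have := (integrable_stdPdf_mul_iff (f := fun x => -x)).2
      ((integrable_pow_gaussianReal 0 1 1).neg.congr (ae_of_all _ fun x => by simp))
    exact this.congr (ae_of_all _ fun x => by simp; ring)
  have h1 := integral_Iic_of_hasDerivAt_of_tendsto' (a := -t) (m := 0)
    (f := stdPdf) (f' := fun x => -x * stdPdf x)
    (fun x _ => hasDerivAt_stdPdf x) hi.integrableOn tendsto_stdPdf_atBot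
  rw [h0, stdCdf_eq_integral, le_div_iff₀ ht]
  calc _ = ∫ x in Set.Iic (-t), stdPdf x * t := by rw [integral_mul_const]
    _ ≤ ∫ x in Set.Iic (-t), -x * stdPdf x := by
        refine setIntegral_mono_on (integrable_stdPdf.mul_const t).integrableOn hi.integrableOn
          measurableSet_Iic fun x hx => ?_
        have hx' : x ≤ -t := hx
        nlinarith [stdPdf_nonneg x]
    _ ≤ _ := by
        rw [h1, sub_zero, stdPdf_neg, stdPdf_eq]
        exact mul_le_of_le_one_left (Real.exp_pos _).le stdPdf_zero_le_one

theorem gaussianReal_Iic_le {m a s t : ℝ} {v : ℝ≥0} (ht : 0 < t) (hv : (v : ℝ) ≤ s ^ 2) (hs : 0 < s)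
    (h : a + s * t ≤ m) : (gaussianReal m v).real (Set.Iic a) ≤ Real.exp (-t ^ 2 / 2) / t := by
  refine le_trans ?_ (gaussianReal_Iic_neg_le ht)
  have hsv : Real.sqrt v ≤ s := Real.sqrt_le_iff.2 ⟨hs.le, hv⟩
  rw [gaussianReal_eq_map m (Real.sqrt v) v (Real.sq_sqrt v.2),
    map_measureReal_apply (by fun_prop) measurableSet_Iic]
  -- For v = 0 the law is a point mass at m > a, and the event is empty.
  rcases (Real.sqrt_nonneg v).eq_or_lt with h0 | h0
  · rw [← h0]
    refine measureReal_mono fun x hx => ?_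
    simp at hx
    nlinarith
  · refine measureReal_mono fun x hx => ?_
    simp only [Set.mem_preimage, Set.mem_Iic] at hx ⊢
    nlinarith

theorem gaussianReal_neg_real (m : ℝ) (v : ℝ≥0) {s : Set ℝ} (hs : MeasurableSet s) :
    (gaussianReal m v).real s = (gaussianReal (-m) v).real (-s) := by
  rw [← gaussianReal_map_neg, map_measureReal_apply (by fun_prop) hs.neg]
  congr 1; ext x; simp

theorem gaussianReal_abs_sub_ge_le (m : ℝ) (v : ℝ≥0) {a : ℝ} (ha : 0 < a) :
    (gaussianReal m v).real {x | a ≤ |x - m|} ≤ v / a ^ 2 := by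
  have h := meas_ge_le_variance_div_sq (μ := gaussianReal m v) (X := fun x => x)
    (memLp_id_gaussianReal (2 : ℝ≥0)) ha
  rw [variance_fun_id_gaussianReal, integral_id_gaussianReal] at h
  exact ENNReal.toReal_le_of_le_ofReal (by positivity) h

/-! ### Taylor expansion of G at the origin -/

/-- The Hermite numbers `H_k(0)`. -/
def hermiteZero (k : ℕ) : ℝ := Polynomial.aeval (0 : ℝ) (Polynomial.hermite k)

theorem hermiteZero_eq (k : ℕ) : hermiteZero k = (hermiteVar 1 k).eval 0 := by
  rw [← scaledHermite_eq 1 zero_le_one]; simp [scaledHermite, hermiteZero]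

theorem hermiteZero_zero : hermiteZero 0 = 1 := by simp [hermiteZero]

theorem hermiteZero_one : hermiteZero 1 = 0 := by simp [hermiteZero]

theorem hermiteZero_add_two (k : ℕ) : hermiteZero (k + 2) = -((k : ℝ) + 1) * hermiteZero k := by
  have e : hermiteVar 1 (k + 2) = Polynomial.X * hermiteVar 1 (k + 1)
    - Polynomial.C 1 * Polynomial.derivative (hermiteVar 1 (k + 1)) := rfl
  simp [hermiteZero_eq, e, derivative_hermiteVar_succ]
  ring

theorem hermiteZero_sq_le (k : ℕ) : hermiteZero k ^ 2 ≤ k.factorial := by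
  induction k using Nat.twoStepInduction with
  | zero => simp [hermiteZero_zero]
  | one => simp [hermiteZero_one]
  | more k ih _ =>
    rw [hermiteZero_add_two, Nat.factorial_succ, Nat.factorial_succ]
    push_cast
    calc _ = ((k : ℝ) + 1) * ((k + 1) * hermiteZero k ^ 2) := by ring
      _ ≤ ((k : ℝ) + 1 + 1) * ((k + 1) * k.factorial) := by gcongr; linarith

theorem hermiteZero_odd (j : ℕ) : hermiteZero (2 * j + 1) = 0 := by
  induction j with
  | zero => exact hermiteZero_one
  | succ j ih => rw [show 2 * (j + 1) + 1 = 2 * j + 1 + 2 by ring, hermiteZero_add_two, ih, mul_zero]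

theorem hermiteZero_even (j : ℕ) :
    hermiteZero (2 * j) / (2 * j).factorial = (-1 / 2) ^ j / j.factorial := by
  induction j with
  | zero => simp [hermiteZero_zero]
  | succ j ih =>
    have h1 : ((2 * j).factorial : ℝ) ≠ 0 := by positivity
    have h2 : (j.factorial : ℝ) ≠ 0 := by positivity
    rw [show 2 * (j + 1) = 2 * j + 2 by ring, hermiteZero_add_two, Nat.factorial_succ,
      Nat.factorial_succ (2 * j), Nat.factorial_succ j, pow_succ]
    rw [div_eq_div_iff h1 h2] at ih
    push_cast
    field_simp
    linear_combination (-2 * ((j : ℝ) + 1)) * ih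

/-- Odd Hermite numbers vanish and the even ones give the coefficients of exp(-w²/2), so N terms of
one series are ⌈N/2⌉ terms of the other. -/
theorem sum_hermiteZero (w : ℝ) (N : ℕ) :
    ∑ k ∈ Finset.range N, (-1) ^ k * hermiteZero k / k.factorial * w ^ k
      = ∑ j ∈ Finset.range ((N + 1) / 2), (-(w ^ 2 / 2)) ^ j / j.factorial := by
  have h2 : ∀ J : ℕ, ∑ k ∈ Finset.range (2 * J), (-1) ^ k * hermiteZero k / k.factorial * w ^ k
      = ∑ j ∈ Finset.range J, (-(w ^ 2 / 2)) ^ j / j.factorial := by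
    intro J
    induction J with
    | zero => simp
    | succ J ih =>
      rw [show 2 * (J + 1) = 2 * J + 1 + 1 by ring, Finset.sum_range_succ, Finset.sum_range_succ,
        ih, hermiteZero_odd, Finset.sum_range_succ _ J, mul_div_assoc, hermiteZero_even, pow_mul,
        pow_mul]
      simp only [mul_zero, zero_div, zero_mul, add_zero, neg_one_sq, one_pow, one_mul]
      rw [show -(w ^ 2 / 2) = (-1 / 2) * w ^ 2 by ring, mul_pow]
      ring
  rcases Nat.even_or_odd' N with ⟨J, rfl | rfl⟩
  · rw [h2]; congr 2; omega
  · rw [show (2 * J + 1 + 1) / 2 = J + 1 by omega, ← h2, show 2 * (J + 1) = 2 * J + 1 + 1 by ring,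
      Finset.sum_range_succ _ (2 * J + 1), hermiteZero_odd]
    simp

theorem abs_exp_sub_sum_le (x : ℝ) (J : ℕ) :
    |Real.exp x - ∑ j ∈ Finset.range J, x ^ j / j.factorial|
      ≤ |x| ^ J * Real.exp |x| / J.factorial := by
  have hs : ∀ y : ℝ, HasSum (fun j : ℕ => y ^ j / j.factorial) (Real.exp y) := fun y => by
    rw [Real.exp_eq_exp_ℝ]; exact NormedSpace.expSeries_div_hasSum_exp y
  have h1 := (hasSum_nat_add_iff' J).2 (hs x)
  have h2 := (hs |x|).mul_left (|x| ^ J / J.factorial)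
  rw [← Real.norm_eq_abs, ← h1.tsum_eq, show |x| ^ J * Real.exp |x| / J.factorial
    = |x| ^ J / J.factorial * Real.exp |x| by ring]
  refine tsum_of_norm_bounded h2 fun k => ?_
  have hf : (J.factorial * k.factorial : ℝ) ≤ (k + J).factorial := by
    rw [add_comm]; exact_mod_cast Nat.le_of_dvd (Nat.factorial_pos _)
      (Nat.factorial_mul_factorial_dvd_factorial_add J k)
  rw [norm_div, norm_pow, Real.norm_eq_abs, Real.norm_natCast, pow_add]
  calc |x| ^ k * |x| ^ J / (k + J).factorial
      ≤ |x| ^ k * |x| ^ J / (J.factorial * k.factorial) := by gcongr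
    _ = _ := by field_simp

/-- Coefficients of the Taylor series of `G(·, β)` at `0`. -/
def taylorCoeff (β : ℝ) : ℕ → ℝ
  | 0 => G 0 β
  | 1 => deriv (fun w => G w β) 0
  | k + 2 => stdPdf 0 * ((-1) ^ k * hermiteZero k / (k + 2).factorial)

/-- The second derivative of G(·, β) is the normal density, whose remainder on [-|w|, |w|] is that
of the exponential series. Two applications of the mean value inequality carry it over to G, each at
the cost of a factor |w|. -/
theorem abs_G_sub_taylor_le_aux (β w : ℝ) (N : ℕ) :
    |G w β - ∑ m ∈ Finset.range (N + 2), taylorCoeff β m * w ^ m|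
      ≤ (w ^ 2 / 2) ^ ((N + 1) / 2) * Real.exp (w ^ 2 / 2) / ((N + 1) / 2).factorial * w ^ 2 := by
  set J := (N + 1) / 2
  set A := (w ^ 2 / 2) ^ J * Real.exp (w ^ 2 / 2) / J.factorial
  have hA : 0 ≤ A := by positivity
  set f0 : ℝ → ℝ := fun x => stdPdf 0 * ∑ k ∈ Finset.range N,
    (-1) ^ k * hermiteZero k / k.factorial * x ^ k with hf0
  set f1 : ℝ → ℝ := fun x => stdPdf 0 * ∑ k ∈ Finset.range N,
    (-1) ^ k * hermiteZero k / (k + 1).factorial * x ^ (k + 1) with hf1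
  set f2 : ℝ → ℝ := fun x => stdPdf 0 * ∑ k ∈ Finset.range N,
    (-1) ^ k * hermiteZero k / (k + 2).factorial * x ^ (k + 2) with hf2
  have d2 : ∀ x, HasDerivAt f2 (f1 x) x := fun x => by
    refine (HasDerivAt.fun_sum fun k _ => ?_).const_mul _
    refine ((hasDerivAt_pow (k + 2) x).const_mul _).congr_deriv ?_
    have h1 : ((k + 1).factorial : ℝ) ≠ 0 := by positivity
    rw [Nat.factorial_succ (k + 1)]
    push_cast
    rw [show (k : ℝ) + 1 + 1 = k + 2 by ring]
    field_simp
  have d1 : ∀ x, HasDerivAt f1 (f0 x) x := fun x => by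
    refine (HasDerivAt.fun_sum fun k _ => ?_).const_mul _
    refine ((hasDerivAt_pow (k + 1) x).const_mul _).congr_deriv ?_
    have h1 : (k.factorial : ℝ) ≠ 0 := by positivity
    rw [Nat.factorial_succ k]
    push_cast
    field_simp
  have b0 : ∀ x ∈ Set.Icc (-|w|) |w|, |stdPdf x - f0 x| ≤ A := by
    intro x hx
    have hxw : x ^ 2 ≤ w ^ 2 := sq_le_sq.2 (abs_le.2 hx)
    simp only [hf0]
    rw [sum_hermiteZero, stdPdf_eq, ← mul_sub, abs_mul, abs_of_nonneg (stdPdf_nonneg 0)]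
    have h := abs_exp_sub_sum_le (-(x ^ 2 / 2)) J
    rw [abs_neg, abs_of_nonneg (by positivity : 0 ≤ x ^ 2 / 2)] at h
    rw [show -x ^ 2 / 2 = -(x ^ 2 / 2) by ring]
    refine (mul_le_of_le_one_left (abs_nonneg _) stdPdf_zero_le_one).trans (h.trans ?_)
    simp only [A]
    gcongr
  have z : (0 : ℝ) ∈ Set.Icc (-|w|) |w| := by simp
  have b1 : ∀ x ∈ Set.Icc (-|w|) |w|, |stdCdf x - stdCdf 0 - f1 x| ≤ A * |w| := by
    intro x hx
    have h := (convex_Icc (-|w|) |w|).norm_image_sub_le_of_norm_hasDerivWithin_le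
      (f := fun x => stdCdf x - f1 x) (fun y _ => ((hasDerivAt_stdCdf y).sub (d1 y)).hasDerivWithinAt)
      b0 z hx
    simp only [Real.norm_eq_abs, sub_zero] at h
    have h10 : f1 0 = 0 := by simp [hf1]
    rw [h10, sub_zero] at h
    calc _ = |stdCdf x - f1 x - stdCdf 0| := by ring_nf
      _ ≤ _ := h.trans (mul_le_mul_of_nonneg_left (abs_le.2 hx) hA)
  have h := (convex_Icc (-|w|) |w|).norm_image_sub_le_of_norm_hasDerivWithin_le
    (f := fun x => expPos x - stdCdf 0 * x - f2 x) (fun y _ => ((((hasDerivAt_expPos y).sub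
      ((hasDerivAt_id y).const_mul _)).sub (d2 y)).congr_deriv (by simp)).hasDerivWithinAt)
    b1 z (⟨neg_abs_le w, le_abs_self w⟩ : w ∈ Set.Icc (-|w|) |w|)
  have h20 : f2 0 = 0 := by simp [hf2]
  simp only [Real.norm_eq_abs, sub_zero, h20, mul_zero] at h
  rw [mul_assoc, ← sq, sq_abs] at h
  refine le_trans (le_of_eq ?_) h
  congr 1
  rw [Finset.sum_range_succ', Finset.sum_range_succ']
  simp only [taylorCoeff, deriv_G]
  simp only [G_eq, hf2, Finset.mul_sum, mul_assoc]
  ring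

/-- With J = ⌈N/2⌉ and x = w²/2 the hypothesis reads e²x ≤ J at worst, so x^J/J! ≤ e^{-J} because
J^J/J! ≤ e^J. The factor e² in K_n(i) is chosen for this: it leaves a decaying exponential after
exp(x) ≤ e^{J/2}. -/
theorem abs_G_sub_taylor_le (β w : ℝ) (N : ℕ) (hN : 0 < N)
    (h : Real.exp 1 ^ 2 * w ^ 2 ≤ N) :
    |G w β - ∑ m ∈ Finset.range (N + 2), taylorCoeff β m * w ^ m| ≤ 16 / N := by
  refine (abs_G_sub_taylor_le_aux β w N).trans ?_
  set J := (N + 1) / 2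
  have hJ : (N : ℝ) ≤ 2 * J := by
    have : N ≤ 2 * J := by omega
    exact_mod_cast this
  have hN' : (0 : ℝ) < N := by exact_mod_cast hN
  have hJ0 : (0 : ℝ) < J := by linarith
  have he : (2 : ℝ) ≤ Real.exp 1 := by linarith [Real.exp_one_gt_d9]
  set x := w ^ 2 / 2 with hx
  have hx0 : 0 ≤ x := by positivity
  have hxJ : Real.exp 1 ^ 2 * x ≤ J := by rw [hx]; linarith
  have h4 : 4 * x ≤ J := le_trans (by gcongr; nlinarith) hxJ
  have h1 : (Real.exp 1 ^ 2 * x) ^ J / J.factorial ≤ Real.exp J :=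
    (by gcongr : _ ≤ (J : ℝ) ^ J / J.factorial).trans (Real.pow_div_factorial_le_exp _ hJ0.le J)
  have h2 : x ^ J / J.factorial ≤ Real.exp (-J) := by
    have h3 : (Real.exp 1 ^ 2) ^ J = Real.exp J * Real.exp J := by
      rw [← Real.exp_nat_mul, ← Real.exp_nat_mul, ← Real.exp_add]; congr 1; push_cast; ring
    rw [mul_pow, h3] at h1
    rw [Real.exp_neg, ← one_div, le_div_iff₀ (Real.exp_pos _)]
    have : Real.exp J * (x ^ J / J.factorial * Real.exp J) ≤ Real.exp J * 1 := by
      calc _ = Real.exp J * Real.exp J * x ^ J / J.factorial := by ring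
        _ ≤ _ := by linarith
    exact le_of_mul_le_mul_left this (Real.exp_pos _)
  have h3 : (J : ℝ) ^ 2 / 8 ≤ Real.exp (J / 2) := by
    have := Real.quadratic_le_exp_of_nonneg (by positivity : (0 : ℝ) ≤ J / 2)
    nlinarith
  calc x ^ J * Real.exp x / J.factorial * w ^ 2 = x ^ J / J.factorial * Real.exp x * (2 * x) := by
        rw [hx]; ring
    _ ≤ Real.exp (-J) * Real.exp (J / 2) * J := by
        gcongr <;> linarith
    _ = J / Real.exp (J / 2) := by
        rw [← Real.exp_add, show -(J : ℝ) + J / 2 = -(J / 2) by ring, Real.exp_neg]; field_simp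
    _ ≤ J / (J ^ 2 / 8) := by gcongr
    _ = 8 / J := by field_simp
    _ ≤ 8 / (N / 2) := by gcongr; linarith
    _ = 16 / N := by field_simp; norm_num

/-! ### The Hermite estimate: unbiasedness and second moment -/

/-- The unbiased estimate of the Taylor polynomial of `G(·, β)`, as a polynomial. -/
def taylorHermite (β v : ℝ) (N : ℕ) : Polynomial ℝ :=
  ∑ m ∈ Finset.range (N + 2), Polynomial.C (taylorCoeff β m) * hermiteVar v m

theorem integral_taylorHermite (β m : ℝ) (v : ℝ≥0) (N : ℕ) :
    ∫ x, (taylorHermite β v N).eval x ∂(gaussianReal m v)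
      = ∑ j ∈ Finset.range (N + 2), taylorCoeff β j * m ^ j := by
  simp only [taylorHermite, Polynomial.eval_finsetSum, Polynomial.eval_mul, Polynomial.eval_C]
  rw [integral_finsetSum _ fun j _ => (integrable_eval_gaussianReal m v _).const_mul _]
  simp only [integral_const_mul, integral_hermiteVar]

/-- The factor k! is the one in `integral_hermiteVar_sq_le`, so each term of the estimate has second
moment at most exp(2m²). -/
theorem taylorCoeff_sq_le {β : ℝ} (h0 : 0 ≤ β) (h1 : β ≤ 1) (k : ℕ) :
    taylorCoeff β k ^ 2 * k.factorial ≤ 1 := by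
  have hφ := stdPdf_zero_le_one
  have hφ0 := stdPdf_nonneg 0
  match k with
  | 0 =>
    simp only [taylorCoeff, G]
    simp
    rw [abs_of_nonneg hφ0]; exact hφ
  | 1 =>
    simp only [taylorCoeff, deriv_G]
    simp
    rw [abs_le]
    constructor <;> linarith [stdCdf_nonneg 0, stdCdf_le_one 0]
  | k + 2 =>
    have hf : (0 : ℝ) < (k + 2).factorial := by positivity
    have h2 : hermiteZero k ^ 2 ≤ (k + 2).factorial :=
      (hermiteZero_sq_le k).trans (by exact_mod_cast Nat.factorial_le (by omega))
    have h3 : ((-1 : ℝ) ^ k) ^ 2 = 1 := by rw [← pow_mul, mul_comm, pow_mul]; simp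
    have h4 : stdPdf 0 ^ 2 ≤ 1 := pow_le_one₀ hφ0 hφ
    calc taylorCoeff β (k + 2) ^ 2 * (k + 2).factorial
        = stdPdf 0 ^ 2 * ((-1 : ℝ) ^ k) ^ 2 * (hermiteZero k ^ 2 / (k + 2).factorial) := by
          simp only [taylorCoeff]; field_simp
      _ ≤ 1 * 1 * 1 := by
          rw [h3]; gcongr; exact (div_le_one hf).2 h2
      _ = 1 := by norm_num

theorem integral_taylorHermite_sq_le {β : ℝ} (h0 : 0 ≤ β) (h1 : β ≤ 1) (m : ℝ) (v : ℝ≥0)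
    (hv : v ≤ 1 / 2) (N : ℕ) :
    ∫ x, (taylorHermite β v N).eval x ^ 2 ∂(gaussianReal m v)
      ≤ ((N : ℝ) + 2) ^ 2 * Real.exp (2 * m ^ 2) := by
  have hi : ∀ p : Polynomial ℝ, Integrable (fun x => p.eval x ^ 2) (gaussianReal m v) := fun p =>
    (integrable_eval_gaussianReal m v (p ^ 2)).congr (ae_of_all _ fun x => by simp)
  have hs : Integrable (fun x => ∑ k ∈ Finset.range (N + 2),
      taylorCoeff β k ^ 2 * (hermiteVar v k).eval x ^ 2) (gaussianReal m v) :=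
    integrable_finsetSum _ fun k _ => (hi _).const_mul _
  calc _ ≤ ∫ x, ((N : ℝ) + 2) * ∑ k ∈ Finset.range (N + 2),
          taylorCoeff β k ^ 2 * (hermiteVar v k).eval x ^ 2 ∂(gaussianReal m v) := by
        -- Cauchy–Schwarz over the N + 2 terms supplies one factor N + 2; summing the uniform bounds
        -- supplies the other.
        refine integral_mono (hi _) (hs.const_mul _) fun x => ?_
        simp only [taylorHermite, Polynomial.eval_finsetSum, Polynomial.eval_mul,
          Polynomial.eval_C]
        have := sq_sum_le_card_mul_sum_sq (s := Finset.range (N + 2))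
          (f := fun k => taylorCoeff β k * (hermiteVar v k).eval x)
        simpa [mul_pow] using this
    _ = ((N : ℝ) + 2) * ∑ k ∈ Finset.range (N + 2),
          taylorCoeff β k ^ 2 * ∫ x, (hermiteVar v k).eval x ^ 2 ∂(gaussianReal m v) := by
        rw [integral_const_mul, integral_finsetSum _ fun k _ => (hi _).const_mul _]
        simp only [integral_const_mul]
    _ ≤ ((N : ℝ) + 2) * ∑ k ∈ Finset.range (N + 2), Real.exp (2 * m ^ 2) := by
        gcongr with k hk
        calc _ ≤ taylorCoeff β k ^ 2 * (k.factorial * Real.exp (2 * m ^ 2)) := by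
              gcongr; exact integral_hermiteVar_sq_le m v hv k
          _ = taylorCoeff β k ^ 2 * k.factorial * Real.exp (2 * m ^ 2) := by ring
          _ ≤ 1 * Real.exp (2 * m ^ 2) := by gcongr; exact taylorCoeff_sq_le h0 h1 k
          _ = _ := one_mul _
    _ = _ := by simp; ring

/-- With N = K - 1, the N summands of `S` together with the constant and linear terms are the N + 2
terms of `taylorHermite`. -/
theorem Model.S_eq (M : Model) (γ : ℕ → ℝ) (n i : ℕ) (τ : ℝ≥0∞) (u : ℝ) :
    M.S γ n i τ u
      = (taylorHermite (M.ratio i) (2 * M.σp i * M.d i τ ^ 2) (M.K γ n i - 1)).eval u := by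
  have hv : 0 ≤ 2 * M.σp i * M.d i τ ^ 2 := by have := M.σp_pos i; positivity
  simp only [Model.S, scaledHermite_eq _ hv, taylorHermite, Polynomial.eval_finsetSum,
    Polynomial.eval_mul, Polynomial.eval_C]
  rw [Finset.sum_range_succ', Finset.sum_range_succ']
  simp only [taylorCoeff, hermiteZero, hermiteVar, Finset.mul_sum, mul_assoc]
  simp
  ring

/-! ### Splitting one observation into two independent ones -/

theorem hasLaw_fst_snd_prod (μ ν : Measure ℝ) [IsProbabilityMeasure μ] [IsProbabilityMeasure ν] :
    HasLaw (Prod.fst : ℝ × ℝ → ℝ) μ (μ.prod ν) ∧ HasLaw (Prod.snd : ℝ × ℝ → ℝ) ν (μ.prod ν) :=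
  ⟨⟨by fun_prop, by simp⟩, ⟨by fun_prop, by simp⟩⟩

/-- Adding and subtracting independent noise of the same variance yields independent Gaussians. -/
theorem map_add_sub_gaussianReal (θ c d r : ℝ) (s v : ℝ≥0) (hr : r ^ 2 = s)
    (hv : (v : ℝ) = 2 * s * d ^ 2) :
    ((gaussianReal θ s).prod (gaussianReal 0 1)).map
        (fun p => (c + d * (p.1 + r * p.2), c + d * (p.1 - r * p.2)))
      = (gaussianReal (c + d * θ) v).prod (gaussianReal (c + d * θ) v) := by
  set P := (gaussianReal θ s).prod (gaussianReal 0 1)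
  obtain ⟨h1, h2⟩ := hasLaw_fst_snd_prod (gaussianReal θ s) (gaussianReal 0 1)
  have hW : ∀ a : ℝ, HasLaw (fun p : ℝ × ℝ => (d * a) * p.2)
      (gaussianReal 0 (NNReal.mk ((d * a) ^ 2) (sq_nonneg _))) P := fun a => by
    simpa using gaussianReal_const_mul h2 (d * a)
  have hX : HasLaw (fun p : ℝ × ℝ => d * p.1)
      (gaussianReal (d * θ) (NNReal.mk (d ^ 2) (sq_nonneg _) * s)) P := by
    simpa using gaussianReal_const_mul h1 d
  have hind : ∀ a : ℝ, IndepFun (fun p : ℝ × ℝ => d * p.1) (fun p : ℝ × ℝ => (d * a) * p.2) P :=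
    fun a => indepFun_prod (X := fun x : ℝ => d * x) (Y := fun y : ℝ => (d * a) * y)
      (by fun_prop) (by fun_prop)
  -- Only a² matters, so a = r and a = -r give both marginals at once.
  have hU : ∀ a : ℝ, a ^ 2 = s → P.map (fun p : ℝ × ℝ => c + (d * p.1 + (d * a) * p.2))
      = gaussianReal (c + d * θ) v := fun a ha => by
    have h : HasLaw (fun p : ℝ × ℝ => d * p.1 + (d * a) * p.2) (gaussianReal (d * θ) v) P := by
      refine ⟨by fun_prop, ?_⟩
      have h3 := gaussianReal_add_gaussianReal_of_indepFun (hind a) hX.map_eq (hW a).map_eq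
      rw [add_zero] at h3
      refine Eq.trans h3 ?_
      congr 1
      ext
      push_cast
      rw [hv]
      simp [mul_pow, ha]
      ring
    rw [(gaussianReal_const_add h c).map_eq, add_comm]
  have hL : HasGaussianLaw (fun p : ℝ × ℝ => (d * p.1 + (d * r) * p.2, d * p.1 - (d * r) * p.2)) P := by
    have h := (hind r).hasGaussianLaw hX.hasGaussianLaw (hW r).hasGaussianLaw
    exact h.map_fun (((ContinuousLinearMap.fst ℝ ℝ ℝ) + (ContinuousLinearMap.snd ℝ ℝ ℝ)).prod
      ((ContinuousLinearMap.fst ℝ ℝ ℝ) - (ContinuousLinearMap.snd ℝ ℝ ℝ)))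
  have mX : MemLp (fun p : ℝ × ℝ => d * p.1) 2 P := hX.hasGaussianLaw.memLp_two
  have mW : MemLp (fun p : ℝ × ℝ => (d * r) * p.2) 2 P := (hW r).hasGaussianLaw.memLp_two
  -- The two summands have equal variance d²s, so sum and difference are uncorrelated; being jointly
  -- Gaussian, they are independent.
  have hcov : cov[fun p : ℝ × ℝ => d * p.1 + (d * r) * p.2,
      fun p : ℝ × ℝ => d * p.1 - (d * r) * p.2; P] = 0 := by
    have e1 : Var[fun p : ℝ × ℝ => d * p.1; P] = d ^ 2 * s := by
      rw [hX.variance_eq, variance_id_gaussianReal]; simp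
    have e2 : Var[fun p : ℝ × ℝ => (d * r) * p.2; P] = d ^ 2 * s := by
      rw [(hW r).variance_eq, variance_id_gaussianReal]; simp [mul_pow, hr]
    have := (hind r).covariance_eq_zero mX mW
    change cov[(fun p : ℝ × ℝ => d * p.1) + (fun p : ℝ × ℝ => (d * r) * p.2),
      (fun p : ℝ × ℝ => d * p.1) - (fun p : ℝ × ℝ => (d * r) * p.2); P] = 0
    rw [covariance_add_left mX mW (mX.sub mW), covariance_sub_right mX mX mW,
      covariance_sub_right mW mX mW, covariance_self mX.aemeasurable, covariance_self mW.aemeasurable,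
      covariance_comm (fun p : ℝ × ℝ => (d * r) * p.2), this, e1, e2]
    ring
  have hI := hL.indepFun_of_covariance_eq_zero hcov
  have hI' := hI.comp (φ := fun x => c + x) (ψ := fun x => c + x) (by fun_prop) (by fun_prop)
  rw [indepFun_iff_map_prod_eq_prod_map_map (by fun_prop) (by fun_prop)] at hI'
  have e1 := hU r hr
  have e2 := hU (-r) (by rw [neg_sq, hr])
  have e3 : (fun p : ℝ × ℝ => c + (d * p.1 + (d * -r) * p.2))
    = (fun x => c + x) ∘ fun p : ℝ × ℝ => d * p.1 - (d * r) * p.2 := by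
    funext p; simp; ring
  rw [e3] at e2
  have e4 : (fun p : ℝ × ℝ => c + (d * p.1 + (d * r) * p.2))
    = (fun x => c + x) ∘ fun p : ℝ × ℝ => d * p.1 + (d * r) * p.2 := rfl
  rw [e4] at e1
  rw [e1, e2] at hI'
  rw [← hI']
  congr 1
  funext p
  simp
  constructor <;> ring

/-! ### Selection by an independent variable -/

/-- Selection among three estimates according to the position of `w` relative to `[-l, l]`. -/
def threeWay (l : ℝ) (f₁ f₂ f₃ : ℝ → ℝ) (p : ℝ × ℝ) : ℝ :=
  if p.2 < -l then f₁ p.1 else if p.2 ≤ l then f₂ p.1 else f₃ p.1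

theorem threeWay_eq (l : ℝ) (hl : 0 ≤ l) (f₁ f₂ f₃ : ℝ → ℝ) (p : ℝ × ℝ) :
    threeWay l f₁ f₂ f₃ p = f₁ p.1 * (Set.Iio (-l)).indicator 1 p.2
      + f₂ p.1 * (Set.Icc (-l) l).indicator 1 p.2 + f₃ p.1 * (Set.Ioi l).indicator 1 p.2 := by
  unfold threeWay
  split_ifs with h1 h2
  · have : ¬ (-l ≤ p.2) := by linarith
    have h3 : ¬ (l < p.2) := by linarith
    simp [h1, this, h3]
  · simp [h1, h2, not_lt.1 h1]
  · simp [h1, h2, not_le.1 h2]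

section ThreeWay

variable {l : ℝ} {f₁ f₂ f₃ : ℝ → ℝ} {μ ν : Measure ℝ} [IsProbabilityMeasure ν]

theorem integrable_indicator_one {s : Set ℝ} (hs : MeasurableSet s) :
    Integrable (s.indicator (1 : ℝ → ℝ)) ν :=
  (integrable_const (1 : ℝ)).indicator hs

theorem integrable_threeWay (hl : 0 ≤ l) (h₁ : Integrable f₁ μ) (h₂ : Integrable f₂ μ)
    (h₃ : Integrable f₃ μ) : Integrable (threeWay l f₁ f₂ f₃) (μ.prod ν) := by
  rw [funext (threeWay_eq l hl f₁ f₂ f₃)]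
  exact ((h₁.mul_prod (integrable_indicator_one measurableSet_Iio)).add
    (h₂.mul_prod (integrable_indicator_one measurableSet_Icc))).add
    (h₃.mul_prod (integrable_indicator_one measurableSet_Ioi))

theorem integral_threeWay [IsProbabilityMeasure μ] (hl : 0 ≤ l) (h₁ : Integrable f₁ μ) (h₂ : Integrable f₂ μ)
    (h₃ : Integrable f₃ μ) :
    ∫ p, threeWay l f₁ f₂ f₃ p ∂(μ.prod ν) = ν.real (Set.Iio (-l)) * ∫ u, f₁ u ∂μ
      + ν.real (Set.Icc (-l) l) * ∫ u, f₂ u ∂μ + ν.real (Set.Ioi l) * ∫ u, f₃ u ∂μ := by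
  have i₁ := h₁.mul_prod (integrable_indicator_one (ν := ν) (measurableSet_Iio (a := -l)))
  have i₂ := h₂.mul_prod (integrable_indicator_one (ν := ν) (measurableSet_Icc (a := -l) (b := l)))
  have i₃ := h₃.mul_prod (integrable_indicator_one (ν := ν) (measurableSet_Ioi (a := l)))
  simp_rw [threeWay_eq l hl]
  rw [integral_add (by exact i₁.add i₂) i₃, integral_add i₁ i₂, integral_prod_mul,
    integral_prod_mul, integral_prod_mul, integral_indicator_one measurableSet_Iio,
    integral_indicator_one measurableSet_Icc, integral_indicator_one measurableSet_Ioi]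
  ring

end ThreeWay

theorem threeWay_sub (l g : ℝ) (f₁ f₂ f₃ : ℝ → ℝ) (p : ℝ × ℝ) :
    threeWay l f₁ f₂ f₃ p - g
      = threeWay l (fun u => f₁ u - g) (fun u => f₂ u - g) (fun u => f₃ u - g) p := by
  unfold threeWay; split_ifs <;> rfl

theorem threeWay_pow (l : ℝ) (k : ℕ) (f₁ f₂ f₃ : ℝ → ℝ) (p : ℝ × ℝ) :
    threeWay l f₁ f₂ f₃ p ^ k
      = threeWay l (fun u => f₁ u ^ k) (fun u => f₂ u ^ k) (fun u => f₃ u ^ k) p := by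
  unfold threeWay; split_ifs <;> rfl

/-! ### Bias and second moment of the pieces -/

/-- Upper tail probability against the error of the linear estimate. -/
theorem tail_mul_expPos_le {m l : ℝ} {v : ℝ≥0} (hv : v ≤ 1 / 2) (hl : 2 ≤ l) :
    (gaussianReal m v).real (Set.Ioi l) * expPos (-m) ≤ 2 / l ∧
      (gaussianReal m v).real (Set.Ioi l) * expPos (-m) ^ 2 ≤ 2 := by
  have hv' : (v : ℝ) ≤ 1 / 2 := by exact_mod_cast hv
  have hp1 : (gaussianReal m v).real (Set.Ioi l) ≤ 1 := measureReal_le_one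
  have hp0 : 0 ≤ (gaussianReal m v).real (Set.Ioi l) := measureReal_nonneg
  have he := expPos_nonneg (-m)
  set p := (gaussianReal m v).real (Set.Ioi l)
  -- For m ≥ l/2 the error is at most 1/m ≤ 2/l. Otherwise it is at most 1 + |m| ≤ 1 + (l - m),
  -- while Chebyshev bounds the probability by (1/2)/(l - m)² with l - m ≥ l/2.
  rcases le_total (l / 2) m with h | h
  · have h1 : expPos (-m) ≤ 2 / l := by
      refine (expPos_le_inv (by linarith)).trans ?_
      rw [div_le_div_iff₀ (by linarith) (by linarith)]; linarith
    have h2 : 2 / l ≤ 1 := (div_le_one (by linarith)).2 hl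
    have h3 : expPos (-m) ≤ 1 := h1.trans h2
    refine ⟨(mul_le_of_le_one_left he hp1).trans h1, ?_⟩
    exact (mul_le_of_le_one_left (sq_nonneg _) hp1).trans ((pow_le_one₀ he h3).trans one_le_two)
  · set a := l - m with ha
    have ha2 : l / 2 ≤ a := by linarith
    have ha1 : 1 ≤ a := by linarith
    have hma : |m| ≤ a := abs_le.2 ⟨by linarith, by linarith⟩
    have h1 : expPos (-m) ≤ 1 + a := (expPos_le (-m)).trans (by rw [abs_neg]; linarith)
    have h2 : p ≤ (1 / 2) / a ^ 2 := by
      refine le_trans ?_ ((gaussianReal_abs_sub_ge_le m v (by linarith : 0 < a)).trans (by gcongr))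
      refine measureReal_mono fun x hx => ?_
      have hx' : l < x := hx
      exact le_trans (by rw [ha]; linarith) (le_abs_self (x - m))
    constructor
    · calc p * expPos (-m) ≤ (1 / 2) / a ^ 2 * (1 + a) := by gcongr
        _ ≤ (1 / 2) / a ^ 2 * (2 * a) := by gcongr; linarith
        _ = 1 / a := by field_simp
        _ ≤ 1 / (l / 2) := by gcongr
        _ = 2 / l := by field_simp
    · calc p * expPos (-m) ^ 2 ≤ (1 / 2) / a ^ 2 * (1 + a) ^ 2 := by gcongr
        _ ≤ (1 / 2) / a ^ 2 * (2 * a) ^ 2 := by gcongr; linarith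
        _ = 2 := by field_simp

theorem tail_mul_expPos_le' {m l : ℝ} {v : ℝ≥0} (hv : v ≤ 1 / 2) (hl : 2 ≤ l) :
    (gaussianReal m v).real (Set.Iio (-l)) * expPos m ≤ 2 / l ∧
      (gaussianReal m v).real (Set.Iio (-l)) * expPos m ^ 2 ≤ 2 := by
  have h := tail_mul_expPos_le (m := -m) hv hl
  rw [neg_neg, gaussianReal_neg_real (-m) v measurableSet_Ioi, neg_neg] at h
  simpa using h

/-- Truncation to `[-n, n]`. -/
def clip (n : ℕ) (x : ℝ) : ℝ := max (-(n : ℝ)) (min (n : ℝ) x)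

theorem measurable_clip (n : ℕ) : Measurable (clip n) := by unfold clip; fun_prop

theorem abs_clip_le (n : ℕ) (x : ℝ) : |clip n x| ≤ n := by
  have hn : (0 : ℝ) ≤ n := Nat.cast_nonneg n
  exact abs_le.2 ⟨le_max_left _ _, max_le (by linarith) (min_le_left _ _)⟩

theorem abs_clip_sub_le {n : ℕ} {g : ℝ} (hg : |g| ≤ n) (x : ℝ) : |clip n x - g| ≤ |x - g| := by
  have h := abs_le.1 hg
  have e : clip n g = g := by
    unfold clip; rw [min_eq_right h.2, max_eq_right h.1]
  nth_rewrite 1 [← e]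
  unfold clip
  rw [max_comm, max_comm _ (min (n : ℝ) g)]
  refine (abs_max_sub_max_le_abs _ _ _).trans ?_
  simpa [min_comm] using abs_min_sub_min_le_max (n : ℝ) x n g

/-- Controls the truncation bias of an estimate by its second moment divided by n. -/
theorem abs_clip_sub_self_le {n : ℕ} (hn : 0 < n) (x : ℝ) : |clip n x - x| ≤ x ^ 2 / n := by
  have hn' : (0 : ℝ) < n := by exact_mod_cast hn
  by_cases hx : |x| ≤ n
  · have h := abs_le.1 hx
    have e : clip n x = x := by
      unfold clip; rw [min_eq_right h.2, max_eq_right h.1]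
    rw [e, sub_self, abs_zero]; positivity
  · push Not at hx
    have h0 := abs_clip_sub_le (n := n) (g := 0) (by simp) x
    have h1 : |clip n x - x| ≤ |x| := by
      unfold clip
      rcases abs_cases x with ⟨h, _⟩ | ⟨h, _⟩
      · rw [h] at hx ⊢
        rw [min_eq_left hx.le, max_eq_right (by linarith)]
        rw [abs_le]; constructor <;> linarith
      · rw [h] at hx ⊢
        rw [min_eq_right (by linarith), max_eq_left (by linarith)]
        rw [abs_le]; constructor <;> linarith
    refine h1.trans ?_
    rw [le_div_iff₀ hn', ← sq_abs, sq]
    gcongr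

section Estimate

variable {β m : ℝ} {v : ℝ≥0} {n : ℕ} {p : Polynomial ℝ} {l : ℝ}

theorem integrable_clip_sub_pow (g : ℝ) (k : ℕ) :
    Integrable (fun u => (clip n (p.eval u) - g) ^ k) (gaussianReal m v) := by
  refine Integrable.of_bound (C := ((n : ℝ) + |g|) ^ k)
    ((((measurable_clip n).comp (by fun_prop)).sub_const g).pow_const k).aestronglyMeasurable
    (ae_of_all _ fun u => ?_)
  rw [norm_pow, Real.norm_eq_abs]
  gcongr
  exact (abs_sub _ _).trans (add_le_add (abs_clip_le n _) le_rfl)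

theorem integrable_mul_sub_pow (a g : ℝ) (k : ℕ) :
    Integrable (fun u => (a * u - g) ^ k) (gaussianReal m v) :=
  (integrable_eval_gaussianReal m v
    ((Polynomial.C a * Polynomial.X - Polynomial.C g) ^ k)).congr (ae_of_all _ fun x => by simp)

theorem integral_mul_sub (a g : ℝ) : ∫ u, (a * u - g) ∂(gaussianReal m v) = a * m - g := by
  have h : Integrable (fun u : ℝ => u) (gaussianReal m v) := by
    simpa using integrable_pow_gaussianReal m v 1
  rw [integral_sub (h.const_mul a) (integrable_const _), integral_const_mul,
    integral_id_gaussianReal]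
  simp

theorem integral_sub_sq : ∫ u, (u - m) ^ 2 ∂(gaussianReal m v) = v := by
  have h := variance_fun_id_gaussianReal (μ := m) (v := v)
  rw [variance_eq_integral (by fun_prop), integral_id_gaussianReal] at h
  exact h

theorem integral_mul_sub_sq_le {a : ℝ} (ha : |a| ≤ 1) (g : ℝ) :
    ∫ u, (a * u - g) ^ 2 ∂(gaussianReal m v) ≤ v + (a * m - g) ^ 2 := by
  have h1 : Integrable (fun u => (u - m) ^ 2) (gaussianReal m v) := by
    simpa using integrable_mul_sub_pow (m := m) (v := v) 1 m 2
  have h2 : Integrable (fun u => (u - m)) (gaussianReal m v) := by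
    simpa only [one_mul, pow_one] using integrable_mul_sub_pow (m := m) (v := v) 1 m 1
  have e : ∀ u, (a * u - g) ^ 2
      = a ^ 2 * (u - m) ^ 2 + (2 * a * (a * m - g)) * (u - m) + (a * m - g) ^ 2 := fun u => by ring
  rw [integral_congr_ae (ae_of_all _ e)]
  rw [integral_add (by exact (h1.const_mul _).add (h2.const_mul _)) (integrable_const _),
    integral_add (h1.const_mul _) (h2.const_mul _), integral_const_mul, integral_const_mul,
    integral_sub_sq]
  have h3 := integral_mul_sub (m := m) (v := v) 1 m
  simp only [one_mul, sub_self] at h3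
  rw [h3]
  have h4 : a ^ 2 ≤ 1 := by rw [← sq_abs]; exact pow_le_one₀ (abs_nonneg _) ha
  have := v.2
  simp
  exact mul_le_of_le_one_left v.2 h4

/-- The threshold estimate, as a function of the two independent Gaussians. -/
def thresholdEst (β : ℝ) (n : ℕ) (p : Polynomial ℝ) (l : ℝ) : ℝ × ℝ → ℝ :=
  threeWay l (fun u => -β * u) (fun u => clip n (p.eval u)) (fun u => (1 - β) * u)

theorem integrable_thresholdEst_sub_pow (hl : 2 ≤ l) (g : ℝ) (k : ℕ) :
    Integrable (fun q => (thresholdEst β n p l q - g) ^ k)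
      ((gaussianReal m v).prod (gaussianReal m v)) := by
  simp_rw [thresholdEst, threeWay_sub, threeWay_pow]
  exact integrable_threeWay (by linarith) (integrable_mul_sub_pow _ _ k)
    (integrable_clip_sub_pow _ k) (integrable_mul_sub_pow _ _ k)

/-- By independence the bias is a sum over the three regions of probability times bias; each linear
piece contributes at most 2/l. -/
theorem abs_integral_thresholdEst_le (hv : v ≤ 1 / 2) (hl : 2 ≤ l) :
    |∫ q, (thresholdEst β n p l q - G m β) ∂((gaussianReal m v).prod (gaussianReal m v))|
      ≤ 4 / l + (gaussianReal m v).real (Set.Icc (-l) l)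
        * |∫ u, (clip n (p.eval u) - G m β) ∂(gaussianReal m v)| := by
  simp_rw [thresholdEst, threeWay_sub]
  rw [integral_threeWay (by linarith) (by simpa using integrable_mul_sub_pow (-β) (G m β) 1)
    (by simpa using integrable_clip_sub_pow (G m β) 1)
    (by simpa using integrable_mul_sub_pow (1 - β) (G m β) 1), integral_mul_sub, integral_mul_sub]
  have h1 : -β * m - G m β = -expPos m := by rw [G_eq]; ring
  have h2 : (1 - β) * m - G m β = -expPos (-m) := by
    rw [G_eq]; linarith [expPos_sub_neg m]
  rw [h1, h2]
  have h3 := (tail_mul_expPos_le (m := m) hv hl).1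
  have h4 := (tail_mul_expPos_le' (m := m) hv hl).1
  have n1 := mul_nonneg (measureReal_nonneg (μ := gaussianReal m v) (s := Set.Ioi l))
    (expPos_nonneg (-m))
  have n2 := mul_nonneg (measureReal_nonneg (μ := gaussianReal m v) (s := Set.Iio (-l)))
    (expPos_nonneg m)
  refine (abs_add_three _ _ _).trans ?_
  rw [abs_mul _ (∫ u, _ ∂_), abs_of_nonneg measureReal_nonneg, mul_neg, mul_neg, abs_neg, abs_neg,
    abs_of_nonneg n1, abs_of_nonneg n2]
  have : 4 / l = 2 / l + 2 / l := by ring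
  linarith

/-- The constant is 5 = 2 · (1/2 + 2): each linear piece contributes at most 1/2 from its variance
and 2 from its squared bias weighted by the tail probability. -/
theorem integral_thresholdEst_sq_le (h0 : 0 ≤ β) (hb : β ≤ 1) (hv : v ≤ 1 / 2) (hl : 2 ≤ l) :
    ∫ q, (thresholdEst β n p l q - G m β) ^ 2 ∂((gaussianReal m v).prod (gaussianReal m v))
      ≤ 5 + (gaussianReal m v).real (Set.Icc (-l) l)
        * ∫ u, (clip n (p.eval u) - G m β) ^ 2 ∂(gaussianReal m v) := by
  simp_rw [thresholdEst, threeWay_sub, threeWay_pow]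
  rw [integral_threeWay (by linarith) (integrable_mul_sub_pow _ _ 2)
    (integrable_clip_sub_pow _ 2) (integrable_mul_sub_pow _ _ 2)]
  have hv' : (v : ℝ) ≤ 1 / 2 := by exact_mod_cast hv
  have h1 : -β * m - G m β = -expPos m := by rw [G_eq]; ring
  have h2 : (1 - β) * m - G m β = -expPos (-m) := by
    rw [G_eq]; linarith [expPos_sub_neg m]
  have i1 := integral_mul_sub_sq_le (m := m) (v := v) (a := -β)
    (by rw [abs_neg, abs_of_nonneg h0]; exact hb) (G m β)
  have i2 := integral_mul_sub_sq_le (m := m) (v := v) (a := 1 - β)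
    (by rw [abs_of_nonneg (by linarith)]; linarith) (G m β)
  rw [h1, neg_sq] at i1
  rw [h2, neg_sq] at i2
  have h3 := (tail_mul_expPos_le (m := m) hv hl).2
  have h4 := (tail_mul_expPos_le' (m := m) hv hl).2
  have p1 := measureReal_nonneg (μ := gaussianReal m v) (s := Set.Ioi l)
  have p2 := measureReal_nonneg (μ := gaussianReal m v) (s := Set.Iio (-l))
  have q1 := measureReal_le_one (μ := gaussianReal m v) (s := Set.Ioi l)
  have q2 := measureReal_le_one (μ := gaussianReal m v) (s := Set.Iio (-l))
  have j1 := mul_le_mul_of_nonneg_left i1 p2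
  have j2 := mul_le_mul_of_nonneg_left i2 p1
  have k1 := mul_le_mul q1 hv' v.2 zero_le_one
  have k2 := mul_le_mul q2 hv' v.2 zero_le_one
  linarith

/-- Estimates on the middle piece when the mean is far out. -/
theorem middle_far {s t₀ : ℝ} (h0 : 0 ≤ β) (hb : β ≤ 1) (hs : 0 < s) (hs1 : s ≤ 1)
    (hv : (v : ℝ) ≤ s ^ 2) (ht : 1 ≤ t₀) (hn : (n : ℝ) = Real.exp (t₀ ^ 2 / 2)) (hl : l ≤ t₀)
    (hm : l + s * t₀ ≤ |m|) :
    (gaussianReal m v).real (Set.Icc (-l) l)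
        * |∫ u, (clip n (p.eval u) - G m β) ∂(gaussianReal m v)| ≤ 11 / t₀ ∧
    (gaussianReal m v).real (Set.Icc (-l) l)
        * ∫ u, (clip n (p.eval u) - G m β) ^ 2 ∂(gaussianReal m v) ≤ 2 * n / t₀ + 100 := by
  set t := (|m| - l) / s with htd
  have htt : t₀ ≤ t := by rw [htd, le_div_iff₀ hs]; linarith
  have hst : |m| = l + s * t := by rw [htd]; field_simp; ring
  have ht1 : 1 ≤ t := ht.trans htt
  have hp : (gaussianReal m v).real (Set.Icc (-l) l) ≤ Real.exp (-t ^ 2 / 2) / t := by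
    rcases le_total 0 m with h | h
    · rw [abs_of_nonneg h] at hst
      exact (measureReal_mono (Set.Icc_subset_Iic_self)).trans
        (gaussianReal_Iic_le (by linarith) hv hs hst.ge)
    · rw [abs_of_nonpos h] at hst
      rw [gaussianReal_neg_real _ _ measurableSet_Icc]
      refine (measureReal_mono fun x hx => ?_).trans
        (gaussianReal_Iic_le (by linarith) hv hs hst.ge)
      have := hx.1
      simp at this ⊢
      linarith
  set P := (gaussianReal m v).real (Set.Icc (-l) l)
  have hP0 : 0 ≤ P := measureReal_nonneg
  set E := Real.exp (-t ^ 2 / 2) with hE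
  have hE0 : 0 < E := Real.exp_pos _
  have hE2 : E ≤ 2 / t ^ 2 := by
    have := Real.add_one_le_exp (t ^ 2 / 2)
    rw [hE, show -t ^ 2 / 2 = -(t ^ 2 / 2) by ring, Real.exp_neg, inv_le_comm₀ (Real.exp_pos _)
      (by positivity)]
    rw [inv_div]; linarith
  -- The decisive balance: n = exp(t₀²/2) and t ≥ t₀, so the small probability cancels the
  -- truncation level n.
  have hnE : n * E ≤ 1 := by
    rw [hn, hE, ← Real.exp_add, Real.exp_le_one_iff]
    nlinarith
  -- Since l ≤ t₀ ≤ t and s ≤ 1, |m| = l + s t ≤ 2t, and 1 ≤ t.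
  have hm2 : 1 + 2 * |m| ≤ 5 * t := by nlinarith
  have hg : |G m β| ≤ 5 * t := (abs_G_le m h0 hb).trans hm2
  have hn0 : (0 : ℝ) ≤ n := Nat.cast_nonneg n
  have hb1 : |∫ u, (clip n (p.eval u) - G m β) ∂(gaussianReal m v)| ≤ n + 5 * t := by
    have := norm_integral_le_of_norm_le_const (μ := gaussianReal m v) (C := n + 5 * t)
      (f := fun u => clip n (p.eval u) - G m β) (ae_of_all _ fun u =>
        (abs_sub _ _).trans (add_le_add (abs_clip_le n _) hg))
    simpa using this
  have hb2 : ∫ u, (clip n (p.eval u) - G m β) ^ 2 ∂(gaussianReal m v)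
      ≤ 2 * n ^ 2 + 2 * (5 * t) ^ 2 := by
    have h1 := integral_mono (μ := gaussianReal m v) (integrable_clip_sub_pow (p := p) (n := n)
      (G m β) 2) (integrable_const (2 * (n : ℝ) ^ 2 + 2 * (5 * t) ^ 2)) fun u => by
        have a1 := sq_le_sq' (by linarith [(abs_le.1 (abs_clip_le n (p.eval u))).1])
          (abs_le.1 (abs_clip_le n (p.eval u))).2
        have a2 := sq_le_sq' (by linarith [(abs_le.1 hg).1]) (abs_le.1 hg).2
        change (clip n (p.eval u) - G m β) ^ 2 ≤ _
        nlinarith [sq_nonneg (clip n (p.eval u) + G m β)]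
    simpa using h1
  have ht0 : 0 < t := by linarith
  constructor
  · calc _ ≤ E / t * (n + 5 * t) := by gcongr
      _ = n * E / t + 5 * E := by field_simp
      _ ≤ 1 / t + 5 * (2 / t ^ 2) := by gcongr
      _ ≤ 1 / t + 5 * (2 / t) := by gcongr; nlinarith
      _ = 11 / t := by ring
      _ ≤ 11 / t₀ := by gcongr
  · calc _ ≤ E / t * (2 * n ^ 2 + 2 * (5 * t) ^ 2) := by gcongr
      _ = 2 * n * (n * E) / t + 50 * t * E := by field_simp; ring
      _ ≤ 2 * n * 1 / t + 50 * t * (2 / t ^ 2) := by gcongr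
      _ = 2 * n / t + 100 / t := by field_simp; ring
      _ ≤ 2 * n / t₀ + 100 / 1 := by gcongr
      _ = _ := by norm_num

/-- Estimates on the middle piece when the mean lies within the range of the Taylor polynomial. -/
theorem middle_near {N : ℕ} (h0 : 0 ≤ β) (hb : β ≤ 1) (hv : v ≤ 1 / 2) (hN : 0 < N) (hn : 0 < n)
    (hm : Real.exp 1 ^ 2 * m ^ 2 ≤ N) (hmn : 1 + 2 * |m| ≤ n) :
    (gaussianReal m v).real (Set.Icc (-l) l)
        * |∫ u, (clip n ((taylorHermite β v N).eval u) - G m β) ∂(gaussianReal m v)|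
      ≤ ((N : ℝ) + 2) ^ 2 * Real.exp (2 * m ^ 2) / n + 16 / N ∧
    (gaussianReal m v).real (Set.Icc (-l) l)
        * ∫ u, (clip n ((taylorHermite β v N).eval u) - G m β) ^ 2 ∂(gaussianReal m v)
      ≤ 2 * (((N : ℝ) + 2) ^ 2 * Real.exp (2 * m ^ 2)) + 2 * (1 + 2 * |m|) ^ 2 := by
  set T := taylorHermite β v N
  have hn' : (0 : ℝ) < n := by exact_mod_cast hn
  have hp1 : (gaussianReal m v).real (Set.Icc (-l) l) ≤ 1 := measureReal_le_one
  have hg : |G m β| ≤ 1 + 2 * |m| := abs_G_le m h0 hb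
  have hi2 : Integrable (fun u => T.eval u ^ 2) (gaussianReal m v) :=
    (integrable_eval_gaussianReal m v (T ^ 2)).congr (ae_of_all _ fun x => by simp)
  have hi1 := integrable_eval_gaussianReal m v T
  have hT2 := integral_taylorHermite_sq_le h0 hb m v hv N
  have hc := integrable_clip_sub_pow (m := m) (v := v) (p := T) (n := n) (G m β) 1
  simp only [pow_one] at hc
  constructor
  · refine (mul_le_of_le_one_left (abs_nonneg _) hp1).trans ?_
    -- By unbiasedness the bias splits into the effect of truncation and the Taylor remainder at m.
    have e : ∫ u, (clip n (T.eval u) - G m β) ∂(gaussianReal m v)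
        = ∫ u, (clip n (T.eval u) - T.eval u) ∂(gaussianReal m v)
          - (G m β - ∑ j ∈ Finset.range (N + 2), taylorCoeff β j * m ^ j) := by
      have hc' : Integrable (fun u => clip n (T.eval u)) (gaussianReal m v) := by
        simpa using integrable_clip_sub_pow (m := m) (v := v) (p := T) (n := n) 0 1
      rw [integral_sub hc' (integrable_const _), integral_sub hc' hi1, integral_taylorHermite]
      simp
    rw [e]
    refine (abs_sub _ _).trans (add_le_add ?_ (abs_G_sub_taylor_le β m N hN hm))
    have h1 := norm_integral_le_of_norm_le (f := fun u => clip n (T.eval u) - T.eval u)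
      (hi2.div_const (n : ℝ)) (ae_of_all _ fun u => (abs_clip_sub_self_le hn (T.eval u)))
    rw [integral_div] at h1
    exact h1.trans (by gcongr)
  · refine (mul_le_of_le_one_left (integral_nonneg fun _ => sq_nonneg _) hp1).trans ?_
    calc _ ≤ ∫ u, (2 * T.eval u ^ 2 + 2 * (1 + 2 * |m|) ^ 2) ∂(gaussianReal m v) := by
          refine integral_mono (integrable_clip_sub_pow _ 2)
            ((hi2.const_mul 2).add (integrable_const _)) fun u => ?_
          have h1 := sq_le_sq.2 (abs_clip_sub_le (hg.trans hmn) (T.eval u))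
          have h2 : G m β ^ 2 ≤ (1 + 2 * |m|) ^ 2 := sq_le_sq' (by linarith [(abs_le.1 hg).1]) (abs_le.1 hg).2
          change (clip n (T.eval u) - G m β) ^ 2 ≤ 2 * T.eval u ^ 2 + 2 * (1 + 2 * |m|) ^ 2
          nlinarith [sq_nonneg (T.eval u + G m β)]
      _ = 2 * ∫ u, T.eval u ^ 2 ∂(gaussianReal m v) + 2 * (1 + 2 * |m|) ^ 2 := by
          rw [integral_add (hi2.const_mul 2) (integrable_const _), integral_const_mul]; simp
      _ ≤ _ := by gcongr

end Estimate

/-! ### Uniform rates for the threshold estimate -/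

/-- Used at L = log n, where the right side is n/√log n. The exponent 3/4 is a rational bound for
2/e, and 3L + 3 bounds the number of Taylor terms. -/
theorem eventually_sq_mul_exp_le :
    ∀ᶠ L : ℝ in atTop, (3 * L + 3) ^ 2 * Real.exp (3 / 4 * L) ≤ Real.exp L / Real.sqrt L := by
  have h1 := (Real.tendsto_pow_mul_exp_neg_atTop_nhds_zero 3).comp
    (tendsto_id.atTop_mul_const (by norm_num : (0 : ℝ) < 1 / 4))
  -- 2304 = 4³ · 36, so this says 36 L³ ≤ exp(L/4), and (3L+3)²√L ≤ 36 L³ for L ≥ 1.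
  have h2 := h1.eventually_le_const (by norm_num : (0 : ℝ) < 1 / 2304)
  filter_upwards [h2, eventually_ge_atTop 1] with L hL hL1
  simp only [Function.comp, id] at hL
  have hs0 : 0 < Real.sqrt L := Real.sqrt_pos.2 (by linarith)
  have hsL : Real.sqrt L ≤ L := by
    rw [Real.sqrt_le_left (by linarith)]; nlinarith
  rw [Real.exp_neg, ← div_eq_mul_inv, div_le_div_iff₀ (Real.exp_pos _) (by norm_num), one_mul] at hL
  have e1 : Real.exp L = Real.exp (3 / 4 * L) * Real.exp (L * (1 / 4)) := by
    rw [← Real.exp_add]; ring_nf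
  rw [le_div_iff₀ hs0, e1]
  calc _ = Real.exp (3 / 4 * L) * ((3 * L + 3) ^ 2 * Real.sqrt L) := by ring
    _ ≤ Real.exp (3 / 4 * L) * ((6 * L) ^ 2 * L) := by gcongr; linarith
    _ ≤ _ := by gcongr; linarith

set_option maxHeartbeats 400000 in
/-- Uniform bounds on bias and mean squared error of the threshold estimate. -/
theorem thresholdEst_bounds {g : ℝ} (hg : 0 < g) :
    ∀ᶠ n : ℕ in atTop, ∀ (β m γ s : ℝ) (v : ℝ≥0), 0 ≤ β → β ≤ 1 → g ≤ γ → 0 < s →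
      (γ + s) ^ 2 ≤ 1 / (2 * Real.exp 1) → (v : ℝ) ≤ s ^ 2 →
      2 ≤ γ * Real.sqrt (2 * Real.log n) ∧
      |∫ q, (thresholdEst β n
          (taylorHermite β v ⌈Real.exp 1 ^ 2 * (γ + s) ^ 2 * (2 * Real.log n)⌉₊)
          (γ * Real.sqrt (2 * Real.log n)) q - G m β) ∂((gaussianReal m v).prod (gaussianReal m v))|
        ≤ (4 / g + 12 + 8 / g ^ 2) / Real.sqrt (Real.log n) ∧
      ∫ q, (thresholdEst β n
          (taylorHermite β v ⌈Real.exp 1 ^ 2 * (γ + s) ^ 2 * (2 * Real.log n)⌉₊)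
          (γ * Real.sqrt (2 * Real.log n)) q - G m β) ^ 2
          ∂((gaussianReal m v).prod (gaussianReal m v))
        ≤ 3 * (n / Real.sqrt (Real.log n)) := by
  have hlog : Tendsto (fun n : ℕ => Real.log n) atTop atTop :=
    Real.tendsto_log_atTop.comp tendsto_natCast_atTop_atTop
  have hlog2 : Tendsto (fun n : ℕ => g * Real.sqrt (2 * Real.log n)) atTop atTop :=
    (Real.tendsto_sqrt_atTop.comp (hlog.const_mul_atTop two_pos)).const_mul_atTop hg
  filter_upwards [hlog.eventually eventually_sq_mul_exp_le, hlog.eventually_ge_atTop 3,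
    hlog2.eventually_ge_atTop 2, eventually_gt_atTop 0] with n hn hL hgt hn0
  intro β m γ s v hβ0 hβ1 hγ hs hγs hv
  set L := Real.log n with hLd
  set t₀ := Real.sqrt (2 * L) with ht₀
  have hn0' : (0 : ℝ) < n := by exact_mod_cast hn0
  rw [hLd, Real.exp_log hn0', ← hLd] at hn
  have hsq : t₀ ^ 2 = 2 * L := Real.sq_sqrt (by linarith)
  have hnexp : (n : ℝ) = Real.exp (t₀ ^ 2 / 2) := by
    rw [hsq, mul_div_cancel_left₀ _ two_ne_zero, hLd, Real.exp_log hn0']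
  have hsL1 : 1 ≤ Real.sqrt L := Real.one_le_sqrt.2 (by linarith)
  have hsLt : Real.sqrt L ≤ t₀ := Real.sqrt_le_sqrt (by linarith)
  have ht1 : 1 ≤ t₀ := hsL1.trans hsLt
  have he : (8 / 3 : ℝ) ≤ Real.exp 1 := by linarith [Real.exp_one_gt_d9]
  have he3 : Real.exp 1 ≤ 3 := by linarith [Real.exp_one_lt_d9]
  have hγ0 : 0 < γ := hg.trans_le hγ
  have hγs' : (γ + s) ^ 2 ≤ 3 / 16 := hγs.trans (by
    rw [div_le_div_iff₀ (by positivity) (by norm_num)]; linarith)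
  have hγs1 : γ + s ≤ 1 := (pow_le_one_iff_of_nonneg (by linarith) two_ne_zero).1 (by linarith)
  have hs1 : s ≤ 1 := by linarith
  have hγ1 : γ ≤ 1 := by linarith
  have hLL : L ≤ L ^ 2 := le_self_pow₀ (by linarith) two_ne_zero
  have hl : 2 ≤ γ * t₀ := hgt.trans (by gcongr)
  have hlt : γ * t₀ ≤ t₀ := mul_le_of_le_one_left (by linarith) hγ1
  have hv2 : (v : ℝ) ≤ 1 / 2 := by
    have := pow_le_pow_left₀ hs.le (by linarith : s ≤ γ + s) 2
    linarith
  have hv' : v ≤ 1 / 2 := by rw [← NNReal.coe_le_coe]; simpa using hv2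
  set N := ⌈Real.exp 1 ^ 2 * (γ + s) ^ 2 * (2 * L)⌉₊ with hNd
  set p := taylorHermite β v N
  have hb := abs_integral_thresholdEst_le (β := β) (m := m) (n := n) (p := p) hv' hl
  have hq := integral_thresholdEst_sq_le (m := m) (n := n) (p := p) hβ0 hβ1 hv' hl
  have hL2 : L ≤ Real.sqrt L ^ 2 := (Real.sq_sqrt (by linarith)).ge
  have hnL : (3 * L + 3) ^ 2 ≤ n / Real.sqrt L := by
    refine le_trans ?_ hn
    exact le_mul_of_one_le_right (by positivity) (Real.one_le_exp (by linarith))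
  have h4 : 4 / (γ * t₀) ≤ 4 / g / Real.sqrt L := by
    rw [div_div]; gcongr
  have hg2 : 0 ≤ 8 / g ^ 2 / Real.sqrt L := by positivity
  refine ⟨hl, ?_⟩
  -- The summand 4/g pays for the two linear pieces, 12 for the far case and for truncation, and
  -- 8/g² for the Taylor remainder.
  rw [add_div, add_div]
  rcases le_total ((γ + s) * t₀) |m| with hm | hm
  · obtain ⟨f1, f2⟩ := middle_far (p := p) hβ0 hβ1 hs hs1 hv ht1 hnexp hlt (by linarith)
    constructor
    · have : 11 / t₀ ≤ 12 / Real.sqrt L := by gcongr; norm_num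
      linarith
    · have : 2 * n / t₀ ≤ 2 * (n / Real.sqrt L) := by rw [← mul_div_assoc]; gcongr
      have h6 : 105 ≤ (3 * L + 3) ^ 2 := by
        have := pow_le_pow_left₀ (by norm_num) (by linarith : 12 ≤ 3 * L + 3) 2
        linarith
      linarith
  · have hm2 : m ^ 2 ≤ (γ + s) ^ 2 * (2 * L) := by
      rw [← hsq, ← mul_pow, ← sq_abs]; gcongr
    have hN1 : Real.exp 1 ^ 2 * (γ + s) ^ 2 * (2 * L) ≤ N := Nat.le_ceil _
    have hN2 : (N : ℝ) ≤ 3 * L + 1 := by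
      refine (Nat.ceil_lt_add_one (by positivity)).le.trans ?_
      have : Real.exp 1 ^ 2 * (γ + s) ^ 2 ≤ 3 / 2 := by
        calc _ ≤ Real.exp 1 ^ 2 * (1 / (2 * Real.exp 1)) := by gcongr
          _ = Real.exp 1 / 2 := by field_simp
          _ ≤ _ := by linarith
      have := mul_le_mul_of_nonneg_right this (by linarith : 0 ≤ 2 * L)
      linarith
    -- The uniform lower bound g on γ forces the Taylor order to grow like log n, so that the
    -- remainder 16/N tends to 0.
    have hN3 : 2 * g ^ 2 * L ≤ N := by
      refine le_trans ?_ hN1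
      have : g ^ 2 ≤ Real.exp 1 ^ 2 * (γ + s) ^ 2 := by
        rw [← mul_pow]
        have : γ + s ≤ Real.exp 1 * (γ + s) := le_mul_of_one_le_left (by linarith) (by linarith)
        gcongr
        linarith
      have := mul_le_mul_of_nonneg_right this (by linarith : 0 ≤ 2 * L)
      linarith
    have hgL : 0 < g ^ 2 * L := by positivity
    have hN0 : 0 < N := by
      have : (0 : ℝ) < N := by linarith
      exact_mod_cast this
    have hmL : m ^ 2 ≤ 3 / 8 * L := by
      have := mul_le_mul_of_nonneg_right hγs' (by linarith : 0 ≤ 2 * L)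
      linarith
    have habs : |m| ≤ L := by
      refine abs_le_of_sq_le_sq ?_ (by linarith)
      linarith
    have hnn : 1 + 2 * |m| ≤ n := by
      have h1 : (n : ℝ) / Real.sqrt L ≤ n := div_le_self hn0'.le hsL1
      have h2 : 1 + 2 * L ≤ (3 * L + 3) ^ 2 := by
        have : 3 * L + 3 ≤ (3 * L + 3) ^ 2 := le_self_pow₀ (by linarith) two_ne_zero
        linarith
      linarith
    obtain ⟨f1, f2⟩ := middle_near (l := γ * t₀) (m := m) hβ0 hβ1 hv' hN0 hn0
      (by refine le_trans ?_ hN1; rw [mul_assoc]; gcongr) hnn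
    have hexp : ((N : ℝ) + 2) ^ 2 * Real.exp (2 * m ^ 2) ≤ n / Real.sqrt L := by
      refine le_trans ?_ hn
      have a1 : (N : ℝ) + 2 ≤ 3 * L + 3 := by linarith
      have a2 : 2 * m ^ 2 ≤ 3 / 4 * L := by linarith
      gcongr
    constructor
    · have h1 : ((N : ℝ) + 2) ^ 2 * Real.exp (2 * m ^ 2) / n ≤ 1 / Real.sqrt L := by
        calc _ ≤ n / Real.sqrt L / n := by gcongr
          _ = _ := by field_simp
      have h2 : 16 / (N : ℝ) ≤ 8 / g ^ 2 / Real.sqrt L := by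
        calc 16 / (N : ℝ) ≤ 16 / (2 * g ^ 2 * L) := by gcongr
          _ = 8 / g ^ 2 / L := by field_simp; norm_num
          _ ≤ _ := by gcongr; exact Real.sqrt_le_iff.2 ⟨by linarith, hLL⟩
      have h3 : 1 / Real.sqrt L ≤ 12 / Real.sqrt L := by gcongr; norm_num
      linarith
    · have h5 : (1 + 2 * |m|) ^ 2 ≤ 2 + 8 * m ^ 2 := by
        have := add_sq_le (a := 1) (b := 2 * |m|)
        rw [mul_pow, sq_abs] at this
        linarith
      have h6 : 9 + 6 * L ≤ (3 * L + 3) ^ 2 := by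
        have := mul_le_mul_of_nonneg_left (by linarith : 3 ≤ 3 * L + 3)
          (by linarith : 0 ≤ 3 * L + 3)
        rw [← sq] at this
        linarith
      linarith

/-! ### Averaging out the added noise -/

/-- Averaging out an independent variable preserves the mean and does not increase the second
moment. -/
theorem memLp_integral_snd {μ ν : Measure ℝ} [IsProbabilityMeasure μ] [IsProbabilityMeasure ν]
    {F : ℝ × ℝ → ℝ} (hF : MemLp F 2 (μ.prod ν)) :
    MemLp (fun x => ∫ z, F (x, z) ∂ν) 2 μ ∧
      ∫ x, (∫ z, F (x, z) ∂ν) ^ 2 ∂μ ≤ ∫ p, F p ^ 2 ∂(μ.prod ν) := by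
  have hF1 : Integrable F (μ.prod ν) := hF.integrable one_le_two
  have hF2 : Integrable (fun p => F p ^ 2) (μ.prod ν) := hF.integrable_sq
  have hle : ∀ᵐ x ∂μ, (∫ z, F (x, z) ∂ν) ^ 2 ≤ ∫ z, F (x, z) ^ 2 ∂ν := by
    filter_upwards [hF2.prod_right_ae, hF1.prod_right_ae] with x hx hx1
    have hm : MemLp (fun z => F (x, z)) 2 ν :=
      (memLp_two_iff_integrable_sq hx1.aestronglyMeasurable).2 hx
    have := variance_nonneg (fun z => F (x, z)) ν
    rw [variance_eq_sub hm] at this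
    simpa using this
  have hm := hF1.integral_prod_left.aestronglyMeasurable
  have hint : Integrable (fun x => (∫ z, F (x, z) ∂ν) ^ 2) μ :=
    hF2.integral_prod_left.mono' (hm.pow 2) (by
      filter_upwards [hle] with x hx
      rw [Real.norm_of_nonneg (sq_nonneg _)]; exact hx)
  refine ⟨(memLp_two_iff_integrable_sq hm).2 hint, ?_⟩
  rw [integral_prod _ hF2]
  exact integral_mono_ae hint hF2.integral_prod_left hle

namespace Model

variable (M : Model)

theorem shrink_nonneg (i : ℕ) (τ : ℝ≥0∞) : 0 ≤ M.shrink i τ := by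
  unfold shrink
  split_ifs
  · exact zero_le_one
  · exact div_nonneg ENNReal.toReal_nonneg (add_nonneg ENNReal.toReal_nonneg (M.σp_pos i).le)

theorem shrink_le_one (i : ℕ) (τ : ℝ≥0∞) : M.shrink i τ ≤ 1 := by
  unfold shrink
  split_ifs
  · exact le_rfl
  · exact div_le_one_of_le₀ (by linarith [M.σp_pos i])
      (add_nonneg ENNReal.toReal_nonneg (M.σp_pos i).le)

theorem ratio_pos (i : ℕ) : 0 < M.ratio i := div_pos (M.b_pos i) (add_pos (M.b_pos i) (M.h_pos i))

theorem ratio_le_one (i : ℕ) : M.ratio i ≤ 1 :=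
  div_le_one_of_le₀ (by linarith [M.h_pos i]) (add_pos (M.b_pos i) (M.h_pos i)).le

theorem Trand_eq (γ : ℕ → ℝ) (n i : ℕ) (τ : ℝ≥0∞) (x z : ℝ) :
    M.Trand γ n i τ x z = thresholdEst (M.ratio i) n
      (taylorHermite (M.ratio i) (2 * M.σp i * M.d i τ ^ 2) (M.K γ n i - 1)) (threshold γ n i)
      (M.U i τ x z, M.V i τ x z) := by
  simp only [Trand, Strunc, S_eq]
  rfl

theorem two_mul_d_sq_le (i : ℕ) (τ : ℝ≥0∞) :
    2 * M.σp i * M.d i τ ^ 2 ≤ 2 * M.σp i / M.σf i := by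
  have h1 := M.σp_pos i
  have h2 := M.σf_pos i
  have h3 := M.shrink_nonneg i τ
  have h4 := M.shrink_le_one i τ
  have h5 : (1 - M.shrink i τ) ^ 2 ≤ 1 := pow_le_one₀ (by linarith) (by linarith)
  rw [d, neg_sq, div_pow, Real.sq_sqrt (by positivity), ← mul_div_assoc]
  refine div_le_div₀ (by positivity) ?_ h2 ?_
  · exact mul_le_of_le_one_right (by positivity) h5
  · have : 0 ≤ M.σp i * M.shrink i τ ^ 2 := by positivity
    linarith

theorem measurable_thresholdEst (β : ℝ) (n : ℕ) (p : Polynomial ℝ) (l : ℝ) :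
    Measurable (thresholdEst β n p l) := by
  unfold thresholdEst threeWay
  have := measurable_clip n
  refine Measurable.ite (measurableSet_lt (by fun_prop) (by fun_prop)) (by fun_prop) ?_
  exact Measurable.ite (measurableSet_le (by fun_prop) (by fun_prop)) (by fun_prop) (by fun_prop)

/-- Push the law of (X, Z) forward to that of (U, V), apply `thresholdEst_bounds`, then average over
Z. The bounds hold for every mean t, so no control of individual θ_i is needed. -/
theorem T_bounds {γ : ℕ → ℝ} (hγ : M.AdmissibleTuning γ) :
    ∃ C, 0 ≤ C ∧ ∀ᶠ n : ℕ in atTop, ∀ (i : ℕ) (τ : ℝ≥0∞) (t : ℝ),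
      MemLp (fun x => M.T γ n i τ x - G (M.c i τ + M.d i τ * t) (M.ratio i)) 2
          (gaussianReal t (M.σp i).toNNReal) ∧
      |∫ x, (M.T γ n i τ x - G (M.c i τ + M.d i τ * t) (M.ratio i))
          ∂(gaussianReal t (M.σp i).toNNReal)| ≤ C / Real.sqrt (Real.log n) ∧
      ∫ x, (M.T γ n i τ x - G (M.c i τ + M.d i τ * t) (M.ratio i)) ^ 2
          ∂(gaussianReal t (M.σp i).toNNReal) ≤ 3 * (n / Real.sqrt (Real.log n)) := by
  obtain ⟨⟨g, hg, hgγ⟩, hγu⟩ := hγ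
  refine ⟨4 / g + 12 + 8 / g ^ 2, by positivity, ?_⟩
  filter_upwards [thresholdEst_bounds hg] with n hn i τ t
  have h1 := M.σp_pos i
  have h2 := M.σf_pos i
  have hd : 0 ≤ 2 * M.σp i * M.d i τ ^ 2 := by positivity
  set v : ℝ≥0 := (2 * M.σp i * M.d i τ ^ 2).toNNReal
  have hv : (v : ℝ) = 2 * M.σp i * M.d i τ ^ 2 := Real.coe_toNNReal _ hd
  set m := M.c i τ + M.d i τ * t
  set s := Real.sqrt (2 * M.σp i / M.σf i) with hs
  have hs0 : 0 < s := Real.sqrt_pos.2 (by positivity)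
  -- With r = √(σ_p/σ_f), γ + s = γ + √2 r ≤ √2 (γ + r) ≤ √2/√(4e) by admissibility of γ.
  have hγs : (γ i + s) ^ 2 ≤ 1 / (2 * Real.exp 1) := by
    have he := Real.exp_pos 1
    have a1 := hγu i
    set r := Real.sqrt (M.σp i / M.σf i) with hr
    have hr0 : 0 ≤ r := Real.sqrt_nonneg _
    have a2 : s = Real.sqrt 2 * r := by
      rw [hs, hr, ← Real.sqrt_mul (by norm_num)]; congr 1; ring
    have a3 : 1 ≤ Real.sqrt 2 := Real.one_le_sqrt.2 (by norm_num)
    have a4 : 0 < γ i := hg.trans_le (hgγ i)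
    have a5 : γ i + s ≤ Real.sqrt 2 * (1 / Real.sqrt (4 * Real.exp 1)) := by
      rw [a2]; nlinarith
    calc _ ≤ (Real.sqrt 2 * (1 / Real.sqrt (4 * Real.exp 1))) ^ 2 := by gcongr
      _ = _ := by
        rw [mul_pow, div_pow, Real.sq_sqrt (by positivity), Real.sq_sqrt (by positivity)]
        field_simp; norm_num
  have hvs : (v : ℝ) ≤ s ^ 2 := by
    rw [hv, hs, Real.sq_sqrt (by positivity)]; exact M.two_mul_d_sq_le i τ
  obtain ⟨b0, b1, b2⟩ := hn (M.ratio i) m (γ i) s v (M.ratio_pos i).le (M.ratio_le_one i) (hgγ i) hs0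
    hγs hvs
  have hK : M.K γ n i - 1 = ⌈Real.exp 1 ^ 2 * (γ i + s) ^ 2 * (2 * Real.log n)⌉₊ := by
    simp [K, hs]
  rw [← hK] at b1 b2
  set p := taylorHermite (M.ratio i) v (M.K γ n i - 1) with hp
  set Φ := fun q : ℝ × ℝ => thresholdEst (M.ratio i) n p (γ i * Real.sqrt (2 * Real.log n)) q
    - G m (M.ratio i) with hΦ
  have hmap := map_add_sub_gaussianReal t (M.c i τ) (M.d i τ) (Real.sqrt (M.σp i))
    (M.σp i).toNNReal v (by rw [Real.sq_sqrt h1.le, Real.coe_toNNReal _ h1.le])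
    (by rw [hv, Real.coe_toNNReal _ h1.le])
  set f := fun q : ℝ × ℝ => (M.c i τ + M.d i τ * (q.1 + Real.sqrt (M.σp i) * q.2),
    M.c i τ + M.d i τ * (q.1 - Real.sqrt (M.σp i) * q.2)) with hf
  have hfm : Measurable f := by fun_prop
  have hΦm : Measurable Φ := (measurable_thresholdEst _ _ _ _).sub_const _
  have hint := integrable_thresholdEst_sub_pow (β := M.ratio i) (m := m) (v := v) (n := n) (p := p)
    b0 (G m (M.ratio i)) 2
  set P := (gaussianReal t (M.σp i).toNNReal).prod (gaussianReal 0 1)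
  have hL2 : MemLp (Φ ∘ f) 2 P := by
    refine (memLp_map_measure_iff hΦm.aestronglyMeasurable hfm.aemeasurable).1 ?_
    rw [hmap]
    exact (memLp_two_iff_integrable_sq hΦm.aestronglyMeasurable).2 hint
  have hT : (fun x => ∫ z, (Φ ∘ f) (x, z) ∂(gaussianReal 0 1))
      =ᵐ[gaussianReal t (M.σp i).toNNReal] fun x => M.T γ n i τ x - G m (M.ratio i) := by
    filter_upwards [(hL2.integrable one_le_two).prod_right_ae] with x hx
    have e : ∀ z, M.Trand γ n i τ x z = (Φ ∘ f) (x, z) + G m (M.ratio i) := fun z => by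
      rw [Trand_eq, ← hv]; simp [hΦ, hf, hp, U, V, threshold]
    simp only [T, e]
    rw [integral_add hx (integrable_const _)]
    simp
  obtain ⟨c1, c2⟩ := memLp_integral_snd hL2
  refine ⟨c1.ae_eq hT, ?_, ?_⟩
  · rw [← integral_congr_ae hT, ← integral_prod _ (hL2.integrable one_le_two)]
    refine le_of_eq_of_le ?_ b1
    rw [← hmap, integral_map hfm.aemeasurable hΦm.aestronglyMeasurable]
    rfl
  · rw [← integral_congr_ae (hT.mono fun x hx => congrArg (· ^ 2) hx)]
    refine c2.trans (le_of_eq_of_le ?_ b2)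
    rw [← hmap, integral_map hfm.aemeasurable (hΦm.pow_const 2).aestronglyMeasurable]
    rfl

end Model

/-! ### The predictive loss and its mean -/

theorem integral_max_sub_gaussianReal (q m : ℝ) {s : ℝ} (hs : 0 < s) {v : ℝ≥0} (hv : s ^ 2 = v) :
    ∫ y, max (q - y) 0 ∂(gaussianReal m v) = s * expPos ((q - m) / s) := by
  rw [integral_gaussianReal_eq_std m s v hv (by fun_prop), expPos_eq_integral,
    ← integral_const_mul]
  congr 1; funext x
  rw [mul_max_of_nonneg _ _ hs.le, mul_zero, mul_sub, mul_div_cancel₀ _ hs.ne']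
  ring_nf

theorem memLp_of_lipschitz {f : ℝ → ℝ} {K t : ℝ} {v : ℝ≥0} (hf : Measurable f)
    (h : ∀ x, |f x - f t| ≤ K * |x - t|) :
    MemLp f 2 (gaussianReal t v) ∧ Var[f; gaussianReal t v] ≤ K ^ 2 * v := by
  have hs : Integrable (fun x => K ^ 2 * (x - t) ^ 2) (gaussianReal t v) :=
    Integrable.const_mul (by simpa only [one_mul] using integrable_mul_sub_pow (m := t) (v := v) 1 t 2) _
  have hle : ∀ x, (f x - f t) ^ 2 ≤ K ^ 2 * (x - t) ^ 2 := fun x => by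
    rw [← sq_abs, ← sq_abs (x - t), ← mul_pow]
    exact pow_le_pow_left₀ (abs_nonneg _) (h x) 2
  have hi : Integrable (fun x => (f x - f t) ^ 2) (gaussianReal t v) :=
    hs.mono' (by fun_prop) (ae_of_all _ fun x => by
      rw [Real.norm_of_nonneg (sq_nonneg _)]; exact hle x)
  have hm : MemLp (fun x => f x - f t) 2 (gaussianReal t v) :=
    (memLp_two_iff_integrable_sq (by fun_prop)).2 hi
  constructor
  · exact (hm.add (memLp_const (f t))).ae_eq (ae_of_all _ fun x => by simp)
  · rw [← variance_sub_const hf.aestronglyMeasurable (f t)]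
    refine (variance_le_expectation_sq (by fun_prop)).trans ?_
    refine (integral_mono hi hs hle).trans ?_
    rw [integral_const_mul, integral_sub_sq]

namespace Model

variable (M : Model)

theorem coordLoss_eq (i : ℕ) (t q : ℝ) :
    M.coordLoss i t q = (M.b i + M.h i)
      * ∫ y, max (q - y) 0 ∂(gaussianReal t (M.σf i).toNNReal) + M.b i * (t - q) := by
  have e : ∀ y : ℝ, M.b i * max (y - q) 0 + M.h i * max (q - y) 0
      = (M.b i + M.h i) * max (q - y) 0 + M.b i * (y - q) := fun y => by
    rcases le_total q y with hx | hx
    · rw [max_eq_right (by linarith : q - y ≤ 0), max_eq_left (by linarith)]; ring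
    · rw [max_eq_left (by linarith : 0 ≤ q - y), max_eq_right (by linarith)]; ring
  unfold coordLoss
  simp only [e]
  have h : Integrable (fun y => y - q) (gaussianReal t (M.σf i).toNNReal) := by
    simpa only [one_mul, pow_one] using
      integrable_mul_sub_pow (m := t) (v := (M.σf i).toNNReal) 1 q 1
  rw [integral_add ((integrable_max_sub _ _ _).const_mul _) (h.const_mul _), integral_const_mul,
    integral_const_mul]
  have := integral_mul_sub (m := t) (v := (M.σf i).toNNReal) 1 q
  simp only [one_mul] at this
  rw [this]

theorem abs_coordLoss_sub_le (i : ℕ) (t q q' : ℝ) :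
    |M.coordLoss i t q - M.coordLoss i t q'| ≤ (M.b i + M.h i) * |q - q'| := by
  have hb := M.b_pos i
  have hh := M.h_pos i
  have hi : ∀ q, Integrable (fun y => M.b i * max (y - q) 0 + M.h i * max (q - y) 0)
      (gaussianReal t (M.σf i).toNNReal) := fun q => by
    have h : Integrable (fun y => y - q) (gaussianReal t (M.σf i).toNNReal) := by
      simpa only [one_mul, pow_one] using
        integrable_mul_sub_pow (m := t) (v := (M.σf i).toNNReal) 1 q 1
    exact (h.pos_part.const_mul _).add ((integrable_max_sub _ _ _).const_mul _)
  unfold coordLoss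
  rw [← integral_sub (hi q) (hi q')]
  have key : ∀ y : ℝ, ‖M.b i * max (y - q) 0 + M.h i * max (q - y) 0
      - (M.b i * max (y - q') 0 + M.h i * max (q' - y) 0)‖ ≤ (M.b i + M.h i) * |q - q'| := by
    intro y
    have h1 : |max (y - q) 0 - max (y - q') 0| ≤ |q - q'| :=
      (abs_max_sub_max_le_abs _ _ _).trans (by rw [abs_sub_comm q q']; ring_nf; rfl)
    have h2 : |max (q - y) 0 - max (q' - y) 0| ≤ |q - q'| :=
      (abs_max_sub_max_le_abs _ _ _).trans (by ring_nf; rfl)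
    calc _ = |M.b i * (max (y - q) 0 - max (y - q') 0) + M.h i * (max (q - y) 0 - max (q' - y) 0)| := by
          rw [Real.norm_eq_abs]; ring_nf
      _ ≤ |M.b i * (max (y - q) 0 - max (y - q') 0)| + |M.h i * (max (q - y) 0 - max (q' - y) 0)| :=
          abs_add_le _ _
      _ ≤ M.b i * |q - q'| + M.h i * |q - q'| := by
          rw [abs_mul, abs_mul, abs_of_pos hb, abs_of_pos hh]; gcongr
      _ = _ := by ring
  have := norm_integral_le_of_norm_le_const (μ := gaussianReal t (M.σf i).toNNReal) (ae_of_all _ key)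
  simpa using this

/-- The predictor of coordinate `i` as a function of the past observation. -/
def coordPredictor (i : ℕ) (τ : ℝ≥0∞) (x : ℝ) : ℝ :=
  M.shrink i τ * x + Real.sqrt (M.σf i + M.shrink i τ * M.σp i) * stdQuantile (M.ratio i)

/-- The weight of coordinate `i` in the risk estimate. -/
def weight (i : ℕ) (τ : ℝ≥0∞) : ℝ :=
  (M.b i + M.h i) * Real.sqrt (M.σf i + M.σp i * M.shrink i τ ^ 2)

/-- The loss depends on X and Y only through Y - αX, which is Gaussian with mean (1-α)t and variance
σ_f + α²σ_p; standardizing it yields c_i and d_i. -/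
theorem integral_coordLoss (i : ℕ) (τ : ℝ≥0∞) (t : ℝ) :
    ∫ x, M.coordLoss i t (M.coordPredictor i τ x) ∂(gaussianReal t (M.σp i).toNNReal)
      = M.weight i τ * G (M.c i τ + M.d i τ * t) (M.ratio i) := by
  have h1 := M.σp_pos i
  have h2 := M.σf_pos i
  have hb := M.b_pos i
  have hh := M.h_pos i
  set α := M.shrink i τ with hα
  have hα0 : 0 ≤ α := M.shrink_nonneg i τ
  set κ := Real.sqrt (M.σf i + α * M.σp i) * stdQuantile (M.ratio i) with hκ
  set s := Real.sqrt (M.σf i + M.σp i * α ^ 2) with hs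
  have hspos : 0 < M.σf i + M.σp i * α ^ 2 := by positivity
  have hs0 : 0 < s := Real.sqrt_pos.2 hspos
  have hs2 : s ^ 2 = M.σf i + M.σp i * α ^ 2 := Real.sq_sqrt hspos.le
  set μ := gaussianReal t (M.σp i).toNNReal
  set ν := gaussianReal t (M.σf i).toNNReal
  set P := μ.prod ν
  set v : ℝ≥0 := (M.σf i + M.σp i * α ^ 2).toNNReal with hvd
  have hv : (v : ℝ) = M.σf i + M.σp i * α ^ 2 := Real.coe_toNNReal _ hspos.le
  obtain ⟨l1, l2⟩ := hasLaw_fst_snd_prod μ ν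
  have hlaw : P.map (fun p : ℝ × ℝ => -α * p.1 + p.2) = gaussianReal ((1 - α) * t) v := by
    have hind : IndepFun (fun p : ℝ × ℝ => -α * p.1) (fun p : ℝ × ℝ => p.2) P :=
      indepFun_prod (X := fun x : ℝ => -α * x) (Y := fun y : ℝ => y) (by fun_prop) (by fun_prop)
    have h3 := gaussianReal_add_gaussianReal_of_indepFun hind
      (gaussianReal_const_mul l1 (-α)).map_eq l2.map_eq
    refine Eq.trans h3 ?_
    congr 1
    · ring
    · ext
      push_cast
      rw [hv, Real.coe_toNNReal _ h1.le, Real.coe_toNNReal _ h2.le]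
      simp
      ring
  have hmax : ∫ x, ∫ y, max (α * x + κ - y) 0 ∂ν ∂μ = s * expPos ((κ - (1 - α) * t) / s) := by
    rw [← integral_max_sub_gaussianReal κ _ hs0 (hs2.trans hv.symm), ← hlaw,
      integral_map (by fun_prop) (by fun_prop)]
    have hint : Integrable (fun p : ℝ × ℝ => max (κ - (-α * p.1 + p.2)) 0) P := by
      have := integrable_max_sub κ ((1 - α) * t) v
      rw [← hlaw] at this
      exact (integrable_map_measure (by fun_prop) (by fun_prop)).1 this
    rw [integral_prod _ hint]
    congr 1; funext x; congr 1; funext y; ring_nf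
  have hω : (κ - (1 - α) * t) / s = M.c i τ + M.d i τ * t := by
    simp only [c, d, ← hα]
    rw [Real.sqrt_div (by positivity), mul_comm (α ^ 2), ← hs, hκ]
    field_simp
    ring
  have hi1 : Integrable (fun x => ∫ y, max (α * x + κ - y) 0 ∂ν) μ := by
    have hint : Integrable (fun p : ℝ × ℝ => max (α * p.1 + κ - p.2) 0) P := by
      have := integrable_max_sub κ ((1 - α) * t) v
      rw [← hlaw] at this
      exact ((integrable_map_measure (by fun_prop) (by fun_prop)).1 this).congr
        (ae_of_all _ fun p => by simp; ring_nf)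
    exact hint.integral_prod_left
  have hi2 : Integrable (fun x => -α * x - (κ - t)) μ := by
    simpa only [pow_one] using
      integrable_mul_sub_pow (m := t) (v := (M.σp i).toNNReal) (-α) (κ - t) 1
  have e : ∀ x, M.coordLoss i t (M.coordPredictor i τ x)
      = (M.b i + M.h i) * ∫ y, max (α * x + κ - y) 0 ∂ν + M.b i * (-α * x - (κ - t)) := fun x => by
    rw [coordLoss_eq]
    simp only [coordPredictor, ← hα, ← hκ]
    congr 2; ring
  simp only [e]
  rw [integral_add (hi1.const_mul _) (hi2.const_mul _), integral_const_mul, integral_const_mul, hmax,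
    integral_mul_sub, hω, weight, ← hα, ← hs, G_eq, ← hω, ratio]
  field_simp
  ring

/-- Difference between risk estimate and loss in one coordinate. -/
def coordError (γ : ℕ → ℝ) (n i : ℕ) (τ : ℝ≥0∞) (t x : ℝ) : ℝ :=
  M.weight i τ * M.T γ n i τ x - M.coordLoss i t (M.coordPredictor i τ x)

theorem ARE_sub_loss (γ θ : ℕ → ℝ) (n : ℕ) (τ : ℝ≥0∞) (x : Fin n → ℝ) :
    M.ARE γ n x τ - M.loss n θ (M.predictor n τ x)
      = (1 / (n : ℝ)) * ∑ i : Fin n, M.coordError γ n i τ (θ i) (x i) := by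
  simp only [ARE, loss, coordError, Finset.sum_sub_distrib, mul_sub]
  rfl

theorem weight_le {B s : ℝ} (hB : ∀ i, M.b i + M.h i ≤ B) (hs : ∀ i, M.σf i + M.σp i ≤ s) (i : ℕ)
    (τ : ℝ≥0∞) : 0 ≤ M.weight i τ ∧ M.weight i τ ≤ B * Real.sqrt s := by
  have hb := M.b_pos i
  have hh := M.h_pos i
  have h1 := M.σp_pos i
  have h3 : M.shrink i τ ^ 2 ≤ 1 := pow_le_one₀ (M.shrink_nonneg i τ) (M.shrink_le_one i τ)
  have hB0 : 0 ≤ B := (by linarith [hB i])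
  have := hs i
  refine ⟨by unfold weight; positivity, ?_⟩
  unfold weight
  gcongr
  · exact hB i
  · nlinarith

/-- The mean of the loss is exactly the target of the estimate, so the bias is that of `T`. The
fluctuation of the loss is bounded, being Lipschitz in X, and is absorbed into n/√log n ≥ 1. -/
theorem coordError_bounds {γ : ℕ → ℝ} (hγ : M.AdmissibleTuning γ) {B s : ℝ}
    (hB : ∀ i, M.b i + M.h i ≤ B) (hs : ∀ i, M.σf i + M.σp i ≤ s) :
    ∃ C, 0 ≤ C ∧ ∀ᶠ n : ℕ in atTop, ∀ (i : ℕ) (τ : ℝ≥0∞) (t : ℝ),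
      MemLp (M.coordError γ n i τ t) 2 (gaussianReal t (M.σp i).toNNReal) ∧
      |∫ x, M.coordError γ n i τ t x ∂(gaussianReal t (M.σp i).toNNReal)|
        ≤ C / Real.sqrt (Real.log n) ∧
      ∫ x, M.coordError γ n i τ t x ^ 2 ∂(gaussianReal t (M.σp i).toNNReal)
        ≤ C * (n / Real.sqrt (Real.log n)) := by
  obtain ⟨C, hC, h⟩ := M.T_bounds hγ
  have hB0 : 0 ≤ B := by linarith [hB 0, M.b_pos 0, M.h_pos 0]
  have hs0 : 0 ≤ s := by linarith [hs 0, M.σp_pos 0, M.σf_pos 0]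
  set W := B * Real.sqrt s with hW
  have hW0 : 0 ≤ W := by positivity
  refine ⟨W * C + (6 * W ^ 2 + 2 * (B ^ 2 * s)), by positivity, ?_⟩
  filter_upwards [h, eventually_ge_atTop 3] with n hn hn3 i τ t
  obtain ⟨m1, m2, m3⟩ := hn i τ t
  obtain ⟨w0, w1⟩ := M.weight_le hB hs i τ
  rw [← hW] at w1
  set μ := gaussianReal t (M.σp i).toNNReal
  set f := fun x => M.coordLoss i t (M.coordPredictor i τ x) with hf
  set g := fun x => M.T γ n i τ x - G (M.c i τ + M.d i τ * t) (M.ratio i) with hg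
  have hbh : 0 ≤ M.b i + M.h i := (add_pos (M.b_pos i) (M.h_pos i)).le
  have hfm : Measurable f := ((M.continuous_coordLoss i t).comp
    (by unfold coordPredictor; fun_prop)).measurable
  have hflip : ∀ x, |f x - f t| ≤ B * |x - t| := fun x => by
    refine (M.abs_coordLoss_sub_le i t _ _).trans ?_
    have : M.coordPredictor i τ x - M.coordPredictor i τ t = M.shrink i τ * (x - t) := by
      unfold coordPredictor; ring
    rw [this, abs_mul, abs_of_nonneg (M.shrink_nonneg i τ)]
    exact mul_le_mul (hB i) (mul_le_of_le_one_left (abs_nonneg _) (M.shrink_le_one i τ))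
      (mul_nonneg (M.shrink_nonneg i τ) (abs_nonneg _)) hB0
  obtain ⟨f1, f2⟩ := memLp_of_lipschitz (v := (M.σp i).toNNReal) hfm hflip
  have hEf : ∫ x, f x ∂μ = M.weight i τ * G (M.c i τ + M.d i τ * t) (M.ratio i) :=
    M.integral_coordLoss i τ t
  have e : ∀ x, M.coordError γ n i τ t x = M.weight i τ * g x - (f x - ∫ x, f x ∂μ) := fun x => by
    rw [hEf]; simp only [coordError, hg, hf]; ring
  have e' : M.coordError γ n i τ t = fun x => M.weight i τ * g x - (f x - ∫ x, f x ∂μ) := funext e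
  have f1' : MemLp (fun x => f x - ∫ x, f x ∂μ) 2 μ := f1.sub (memLp_const _)
  have hsl : 0 < Real.sqrt (Real.log n) := Real.sqrt_pos.2 (Real.log_pos (by
    have : (3 : ℝ) ≤ n := by exact_mod_cast hn3
    linarith))
  have hsln : 1 ≤ n / Real.sqrt (Real.log n) := by
    rw [le_div_iff₀ hsl, one_mul, Real.sqrt_le_left (by positivity)]
    have h3 : (3 : ℝ) ≤ n := by exact_mod_cast hn3
    have := Real.log_le_sub_one_of_pos (by linarith : (0 : ℝ) < n)
    nlinarith
  refine ⟨e' ▸ (m1.const_mul _).sub f1', ?_, ?_⟩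
  · have e0 : ∫ x, M.coordError γ n i τ t x ∂μ = M.weight i τ * ∫ x, g x ∂μ := by
      rw [e', integral_sub ((m1.integrable one_le_two).const_mul _) (f1'.integrable one_le_two),
        integral_const_mul, integral_sub (f1.integrable one_le_two) (integrable_const _)]
      simp [μ]
    rw [e0, abs_mul, abs_of_nonneg w0]
    calc _ ≤ W * (C / Real.sqrt (Real.log n)) := by gcongr
      _ = W * C / Real.sqrt (Real.log n) := by ring
      _ ≤ _ := by gcongr; exact le_add_of_nonneg_right (by positivity)
  · rw [variance_eq_integral hfm.aemeasurable] at f2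
    have i1 : Integrable (fun x => 2 * W ^ 2 * g x ^ 2) μ := m1.integrable_sq.const_mul _
    have i2 : Integrable (fun x => 2 * (f x - ∫ x, f x ∂μ) ^ 2) μ := f1'.integrable_sq.const_mul _
    calc _ ≤ ∫ x, (2 * W ^ 2 * g x ^ 2 + 2 * (f x - ∫ x, f x ∂μ) ^ 2) ∂μ := by
          refine integral_mono ?_ (i1.add i2) fun x => ?_
          · rw [e']; exact ((m1.const_mul _).sub f1').integrable_sq
          · simp only [e]
            have a1 : (M.weight i τ * g x) ^ 2 ≤ W ^ 2 * g x ^ 2 := by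
              rw [mul_pow]; gcongr
            change _ ≤ 2 * W ^ 2 * g x ^ 2 + 2 * (f x - ∫ x, f x ∂μ) ^ 2
            nlinarith [sq_nonneg (M.weight i τ * g x + (f x - ∫ x, f x ∂μ))]
      _ = 2 * W ^ 2 * ∫ x, g x ^ 2 ∂μ + 2 * ∫ x, (f x - ∫ x, f x ∂μ) ^ 2 ∂μ := by
          rw [integral_add i1 i2, integral_const_mul, integral_const_mul]
      _ ≤ 2 * W ^ 2 * (3 * (n / Real.sqrt (Real.log n)))
          + 2 * (B ^ 2 * s) * (n / Real.sqrt (Real.log n)) := by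
          have hσ : (((M.σp i).toNNReal : ℝ≥0) : ℝ) ≤ s := by
            rw [Real.coe_toNNReal _ (M.σp_pos i).le]; linarith [hs i, M.σf_pos i]
          have a2 : ∫ x, (f x - ∫ x, f x ∂μ) ^ 2 ∂μ ≤ B ^ 2 * s := f2.trans (by gcongr)
          have a3 : 2 * (B ^ 2 * s) ≤ 2 * (B ^ 2 * s) * (n / Real.sqrt (Real.log n)) :=
            le_mul_of_one_le_right (by positivity) hsln
          have a4 := mul_le_mul_of_nonneg_left m3 (by positivity : 0 ≤ 2 * W ^ 2)
          linarith
      _ ≤ _ := by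
          have : 0 ≤ W * C * (n / Real.sqrt (Real.log n)) := by positivity
          linarith

end Model

/-! ### Concentration of the average error -/

/-- Chebyshev's inequality for averages of independent variables with small mean. -/
theorem pi_measure_abs_average_ge_le {n : ℕ} (hn : 0 < n) {μ : Fin n → Measure ℝ}
    [∀ i, IsProbabilityMeasure (μ i)] {f : Fin n → ℝ → ℝ} (hf : ∀ i, MemLp (f i) 2 (μ i))
    {b V ε : ℝ} (hε : 0 < ε) (hb : ∀ i, |∫ x, f i x ∂(μ i)| ≤ b) (hV : ∀ i, ∫ x, f i x ^ 2 ∂(μ i) ≤ V) :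
    Measure.pi μ {x | ε ≤ |(1 / (n : ℝ)) * ∑ i, f i (x i)|}
      ≤ ENNReal.ofReal ((V / n + b ^ 2) / ε ^ 2) := by
  have hn' : (0 : ℝ) < n := by exact_mod_cast hn
  set F : (Fin n → ℝ) → ℝ := ∑ i, fun x => f i (x i) with hF
  have hmi : ∀ i, MemLp (fun x : Fin n → ℝ => f i (x i)) 2 (Measure.pi μ) := fun i =>
    (hf i).comp_measurePreserving (measurePreserving_eval _ i)
  have hFm : MemLp F 2 (Measure.pi μ) := memLp_finsetSum' _ fun i _ => hmi i
  have hvar := variance_sum_pi hf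
  rw [← hF, variance_eq_sub hFm] at hvar
  have hmean : |∫ x, F x ∂(Measure.pi μ)| ≤ n * b := by
    have : ∫ x, F x ∂(Measure.pi μ) = ∑ i, ∫ x, f i x ∂(μ i) := by
      simp only [hF, Finset.sum_apply]
      rw [integral_finsetSum _ fun i _ => (hmi i).integrable one_le_two]
      exact Finset.sum_congr rfl fun i _ => integral_comp_eval (hf i).aestronglyMeasurable
    rw [this]
    refine (Finset.abs_sum_le_sum_abs _ _).trans ((Finset.sum_le_sum fun i _ => hb i).trans ?_)
    simp
  have hsum : ∑ i, Var[f i; μ i] ≤ n * V := by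
    refine (Finset.sum_le_sum fun i _ => (variance_le_expectation_sq
      (hf i).aestronglyMeasurable).trans (hV i)).trans ?_
    simp
  have hsec : ∫ x, F x ^ 2 ∂(Measure.pi μ) ≤ n * V + (n * b) ^ 2 := by
    have h2 : (∫ x, F x ∂(Measure.pi μ)) ^ 2 ≤ (n * b) ^ 2 := by
      rw [← sq_abs]; gcongr
    have h3 : ∫ x, F x ^ 2 ∂(Measure.pi μ) - (∫ x, F x ∂(Measure.pi μ)) ^ 2
      = ∑ i, Var[f i; μ i] := hvar
    linarith
  have hmk := mul_meas_ge_le_integral_of_nonneg (μ := Measure.pi μ) (f := fun x => F x ^ 2)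
    (ae_of_all _ fun x => sq_nonneg _) hFm.integrable_sq ((n * ε) ^ 2)
  have hset : {x | ε ≤ |(1 / (n : ℝ)) * ∑ i, f i (x i)|} ⊆ {x | (n * ε) ^ 2 ≤ F x ^ 2} := by
    intro x hx
    have hx' : ε ≤ |(1 / (n : ℝ)) * ∑ i, f i (x i)| := hx
    rw [abs_mul, abs_of_pos (by positivity), one_div, ← div_eq_inv_mul, le_div_iff₀ hn'] at hx'
    have e : F x = ∑ i, f i (x i) := by simp [hF]
    change (n * ε) ^ 2 ≤ F x ^ 2
    rw [e, ← sq_abs (∑ i, f i (x i))]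
    gcongr
    linarith
  refine (measure_mono hset).trans ?_
  rw [← ofReal_measureReal]
  refine ENNReal.ofReal_le_ofReal ?_
  rw [le_div_iff₀ (by positivity)]
  have h5 : (n : ℝ) ^ 2 * ((Measure.pi μ).real {x | (n * ε) ^ 2 ≤ F x ^ 2} * ε ^ 2)
      ≤ (n : ℝ) ^ 2 * (V / n + b ^ 2) := by
    calc _ = (n * ε) ^ 2 * (Measure.pi μ).real {x | (n * ε) ^ 2 ≤ F x ^ 2} := by ring
      _ ≤ n * V + (n * b) ^ 2 := hmk.trans hsec
      _ = _ := by field_simp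
  exact le_of_mul_le_mul_left h5 (by positivity)

/-! ### Discretization of the shrinkage parameter -/

/-- The shrinkage factor in the compactified parameter `t = τ / (1 + τ)`. -/
def shrinkParam (σ t : ℝ) : ℝ := t / (t + (1 - t) * σ)

/-- The denominator is a convex combination of 1 and σ, hence at least min(1, σ), and σ/min(1, σ)² =
max(σ, 1/σ). -/
theorem abs_shrinkParam_sub_le {σ C t t' : ℝ} (hσ : 0 < σ) (hC : max σ σ⁻¹ ≤ C)
    (ht : t ∈ Set.Icc (0 : ℝ) 1) (ht' : t' ∈ Set.Icc (0 : ℝ) 1) :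
    |shrinkParam σ t - shrinkParam σ t'| ≤ C * |t - t'| := by
  have hD : ∀ t ∈ Set.Icc (0 : ℝ) 1, min 1 σ ≤ t + (1 - t) * σ := fun t ht => by
    have h1 := mul_le_mul_of_nonneg_left (min_le_left 1 σ) ht.1
    have h2 := mul_le_mul_of_nonneg_left (min_le_right 1 σ) (by linarith [ht.2] : 0 ≤ 1 - t)
    linarith
  have hm : 0 < min 1 σ := lt_min one_pos hσ
  have h1 := hD t ht
  have h2 := hD t' ht'
  have p1 : 0 < t + (1 - t) * σ := hm.trans_le h1
  have p2 : 0 < t' + (1 - t') * σ := hm.trans_le h2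
  have e : shrinkParam σ t - shrinkParam σ t'
      = σ / ((t + (1 - t) * σ) * (t' + (1 - t') * σ)) * (t - t') := by
    unfold shrinkParam
    rw [div_sub_div _ _ p1.ne' p2.ne', div_mul_eq_mul_div]
    congr 1; ring
  rw [e, abs_mul, abs_of_pos (by positivity)]
  gcongr
  refine le_trans ?_ hC
  calc _ ≤ σ / (min 1 σ * min 1 σ) := by gcongr
    _ ≤ max σ σ⁻¹ := by
      rcases le_total 1 σ with h | h
      · rw [min_eq_left h]; simp
      · rw [min_eq_right h, div_mul_cancel_left₀ hσ.ne']; exact le_max_right _ _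

theorem exists_near_multiple {δ t : ℝ} (hδ : 0 < δ) (ht : t ∈ Set.Icc (0 : ℝ) 1) :
    ∃ j : ℕ, j < ⌈1 / δ⌉₊ ∧ |j * δ - t| ≤ δ := by
  have hc : 0 < ⌈1 / δ⌉₊ := Nat.ceil_pos.2 (by positivity)
  by_cases h : ⌊t / δ⌋₊ < ⌈1 / δ⌉₊
  · refine ⟨_, h, ?_⟩
    have h1 := Nat.floor_le (div_nonneg ht.1 hδ.le)
    have h2 := Nat.lt_floor_add_one (t / δ)
    rw [le_div_iff₀ hδ] at h1
    rw [div_lt_iff₀ hδ] at h2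
    rw [abs_le]; constructor <;> linarith
  -- The floor can leave the index range only for t = 1; the last node then lies within δ of 1.
  · have h1 : t = 1 := by
      refine le_antisymm ht.2 ?_
      have h2 : ⌈1 / δ⌉₊ ≤ ⌊t / δ⌋₊ := not_lt.1 h
      have h3 : (1 / δ : ℝ) ≤ t / δ := (Nat.le_ceil _).trans
        ((by exact_mod_cast h2 : (⌈1 / δ⌉₊ : ℝ) ≤ ⌊t / δ⌋₊).trans
          (Nat.floor_le (div_nonneg ht.1 hδ.le)))
      exact (div_le_div_iff_of_pos_right hδ).1 h3
    refine ⟨⌈1 / δ⌉₊ - 1, by omega, ?_⟩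
    have h4 := Nat.lt_ceil.1 (by omega : ⌈1 / δ⌉₊ - 1 < ⌈1 / δ⌉₊)
    have h5 := Nat.le_ceil (1 / δ)
    rw [lt_div_iff₀ hδ] at h4
    rw [div_le_iff₀ hδ] at h5
    rw [Nat.cast_sub hc, Nat.cast_one] at h4 ⊢
    rw [h1, abs_le]; constructor <;> linarith

namespace Model

variable (M : Model)

theorem exists_shrink_eq_shrinkParam (τ : ℝ≥0∞) :
    ∃ t ∈ Set.Icc (0 : ℝ) 1, ∀ i, M.shrink i τ = shrinkParam (M.σp i) t := by
  by_cases h : τ = ∞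
  · exact ⟨1, by simp, fun i => by simp [shrink, h, shrinkParam]⟩
  · have h0 : 0 ≤ τ.toReal := ENNReal.toReal_nonneg
    refine ⟨τ.toReal / (1 + τ.toReal), ⟨by positivity, div_le_one_of_le₀ (by linarith)
      (by positivity)⟩, fun i => ?_⟩
    have hi := M.σp_pos i
    have e : τ.toReal / (1 + τ.toReal) + (1 - τ.toReal / (1 + τ.toReal)) * M.σp i
        = (τ.toReal + M.σp i) / (1 + τ.toReal) := by field_simp; ring
    simp only [shrink, h, if_false, shrinkParam]
    rw [e, div_div_div_cancel_right₀ (by positivity)]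

theorem shrink_grid (i : ℕ) {t : ℝ} (h0 : 0 ≤ t) (h1 : t < 1) :
    M.shrink i (ENNReal.ofReal t / ENNReal.ofReal (1 - t)) = shrinkParam (M.σp i) t := by
  have h2 : 0 < 1 - t := by linarith
  have hi := M.σp_pos i
  rw [← ENNReal.ofReal_div_of_pos h2]
  simp only [shrink, ENNReal.ofReal_ne_top, if_false, shrinkParam,
    ENNReal.toReal_ofReal (div_nonneg h0 h2.le)]
  field_simp

theorem exists_grid_near {δ C : ℝ} (hδ : 0 < δ) (hC : ∀ i, max (M.σp i) (M.σp i)⁻¹ ≤ C)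
    (τ : ℝ≥0∞) : ∃ j : ℕ, j < ⌈1 / δ⌉₊ ∧
      ∀ i, |M.shrink i (ENNReal.ofReal (j * δ) / ENNReal.ofReal (1 - j * δ)) - M.shrink i τ|
        ≤ C * δ := by
  obtain ⟨t, ht, hs⟩ := M.exists_shrink_eq_shrinkParam τ
  obtain ⟨j, hj, hjt⟩ := exists_near_multiple hδ ht
  refine ⟨j, hj, fun i => ?_⟩
  have h0 : 0 ≤ j * δ := by positivity
  have h1 : j * δ < 1 := by
    have := Nat.lt_ceil.1 hj
    rwa [lt_div_iff₀ hδ] at this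
  rw [M.shrink_grid i h0 h1, hs i]
  have hC0 : 0 ≤ C := ((M.σp_pos i).le.trans (le_max_left _ _)).trans (hC i)
  exact (abs_shrinkParam_sub_le (M.σp_pos i) (hC i) ⟨h0, h1.le⟩ ht).trans (by gcongr)

/-- Rationalizing the difference of square roots gives the factor σ_p/√σ_f = √σ_f · (σ_p/σ_f), which
is why C₃ bounds σ_p/σ_f times the quantile. -/
theorem abs_coordPredictor_sub_le {s C₃ : ℝ} (hs : ∀ i, M.σf i ≤ s)
    (hC₃ : ∀ i, M.σp i / M.σf i * |stdQuantile (M.ratio i)| ≤ C₃) (i : ℕ) (τ τ' : ℝ≥0∞) (x : ℝ) :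
    |M.coordPredictor i τ x - M.coordPredictor i τ' x|
      ≤ |M.shrink i τ - M.shrink i τ'| * (|x| + Real.sqrt s * C₃) := by
  have h1 := M.σp_pos i
  have h2 := M.σf_pos i
  set α := M.shrink i τ
  set α' := M.shrink i τ'
  set z := stdQuantile (M.ratio i)
  have hα : 0 ≤ α := M.shrink_nonneg i τ
  have hα' : 0 ≤ α' := M.shrink_nonneg i τ'
  have hf0 : 0 < Real.sqrt (M.σf i) := Real.sqrt_pos.2 h2
  set a := Real.sqrt (M.σf i + α * M.σp i) with ha
  set a' := Real.sqrt (M.σf i + α' * M.σp i) with ha'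
  have ha0 : Real.sqrt (M.σf i) ≤ a := Real.sqrt_le_sqrt (by nlinarith)
  have ha1 : 0 ≤ a' := Real.sqrt_nonneg _
  have hdiff : |a - a'| ≤ M.σp i / Real.sqrt (M.σf i) * |α - α'| := by
    have e : (a - a') * (a + a') = M.σp i * (α - α') := by
      have e1 : a ^ 2 = M.σf i + α * M.σp i := Real.sq_sqrt (by positivity)
      have e2 : a' ^ 2 = M.σf i + α' * M.σp i := Real.sq_sqrt (by positivity)
      linear_combination e1 - e2
    have e2 : |a - a'| * (a + a') = M.σp i * |α - α'| := by
      rw [← abs_of_pos (by linarith : 0 < a + a'), ← abs_mul, e, abs_mul, abs_of_pos h1]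
    rw [div_mul_eq_mul_div, le_div_iff₀ hf0, ← e2]
    gcongr
    linarith
  have hz : M.σp i / Real.sqrt (M.σf i) * |z| ≤ Real.sqrt s * C₃ := by
    have e : M.σp i / Real.sqrt (M.σf i) = Real.sqrt (M.σf i) * (M.σp i / M.σf i) := by
      rw [div_eq_iff hf0.ne', mul_right_comm, Real.mul_self_sqrt h2.le]; field_simp
    rw [e, mul_assoc]
    have h0 : 0 ≤ M.σp i / M.σf i * |z| := by positivity
    have := hC₃ i
    gcongr
    exact hs i
  have e : M.coordPredictor i τ x - M.coordPredictor i τ' x = (α - α') * x + (a - a') * z := by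
    simp only [coordPredictor]; ring
  rw [e]
  refine (abs_add_le _ _).trans ?_
  rw [abs_mul, abs_mul, mul_add]
  refine add_le_add le_rfl ?_
  calc |a - a'| * |z| ≤ M.σp i / Real.sqrt (M.σf i) * |α - α'| * |z| := by gcongr
    _ = |α - α'| * (M.σp i / Real.sqrt (M.σf i) * |z|) := by ring
    _ ≤ _ := by gcongr

theorem loss_le_loss_add {n : ℕ} (hn : 0 < n) (θ : ℕ → ℝ) {B s C₃ η : ℝ}
    (hB : ∀ i, M.b i + M.h i ≤ B) (hs : ∀ i, M.σf i ≤ s)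
    (hC₃ : ∀ i, M.σp i / M.σf i * |stdQuantile (M.ratio i)| ≤ C₃) {τ τ' : ℝ≥0∞}
    (hτ : ∀ i, |M.shrink i τ - M.shrink i τ'| ≤ η) (x : Fin n → ℝ) :
    M.loss n θ (M.predictor n τ x) ≤ M.loss n θ (M.predictor n τ' x)
      + B * η * ((1 / (n : ℝ)) * ∑ i, |x i| + Real.sqrt s * C₃) := by
  have hn' : (0 : ℝ) < n := by exact_mod_cast hn
  have hB0 : 0 ≤ B := by linarith [hB 0, M.b_pos 0, M.h_pos 0]
  have hC0 : 0 ≤ C₃ := le_trans (mul_nonneg (div_pos (M.σp_pos 0) (M.σf_pos 0)).le (abs_nonneg _))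
    (hC₃ 0)
  have key : ∀ i : Fin n, M.coordLoss i (θ i) (M.predictor n τ x i)
      ≤ M.coordLoss i (θ i) (M.predictor n τ' x i) + B * (η * (|x i| + Real.sqrt s * C₃)) := by
    intro i
    have h1 := (le_abs_self _).trans
      (M.abs_coordLoss_sub_le i (θ i) (M.predictor n τ x i) (M.predictor n τ' x i))
    have h2 : |M.predictor n τ x i - M.predictor n τ' x i| ≤ η * (|x i| + Real.sqrt s * C₃) :=
      (M.abs_coordPredictor_sub_le hs hC₃ i τ τ' (x i)).trans (by gcongr; exact hτ i)
    have h3 := mul_le_mul (hB i) h2 (abs_nonneg _) hB0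
    linarith
  unfold loss
  calc _ ≤ (1 / (n : ℝ)) * ∑ i : Fin n, (M.coordLoss i (θ i) (M.predictor n τ' x i)
          + B * (η * (|x i| + Real.sqrt s * C₃))) := by
        gcongr with i; exact key i
    _ = _ := by
        rw [Finset.sum_add_distrib, ← Finset.mul_sum, ← Finset.mul_sum, Finset.sum_add_distrib]
        simp
        field_simp

theorem integrable_abs_eval_pastLaw (θ : ℕ → ℝ) (n : ℕ) (i : Fin n) :
    Integrable (fun x : Fin n → ℝ => |x i|) (M.pastLaw θ n) := by
  have h : Integrable (fun x : ℝ => |x|) (gaussianReal (θ i) (M.σp i).toNNReal) := by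
    simpa using (integrable_pow_gaussianReal (θ i) (M.σp i).toNNReal 1).abs
  exact (measurePreserving_eval (fun i : Fin n => gaussianReal (θ i) (M.σp i).toNNReal) i).integrable_comp_of_integrable h

theorem integral_abs_eval_pastLaw_le (θ : ℕ → ℝ) (n : ℕ) (i : Fin n) {s : ℝ} (hs : M.σp i ≤ s) :
    ∫ x, |x i| ∂(M.pastLaw θ n) ≤ |θ i| + (1 + s) := by
  have e : ∫ x, |x i| ∂(M.pastLaw θ n)
      = ∫ y, |y| ∂(gaussianReal (θ i) (M.σp i).toNNReal) :=
    integral_comp_eval (μ := fun i : Fin n => gaussianReal (θ i) (M.σp i).toNNReal)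
      (f := fun y => |y|) (by fun_prop)
  rw [e]
  have h : Integrable (fun x : ℝ => |x|) (gaussianReal (θ i) (M.σp i).toNNReal) := by
    simpa using (integrable_pow_gaussianReal (θ i) (M.σp i).toNNReal 1).abs
  have h2 : Integrable (fun u => (u - θ i) ^ 2) (gaussianReal (θ i) (M.σp i).toNNReal) := by
    simpa only [one_mul] using
      integrable_mul_sub_pow (m := θ i) (v := (M.σp i).toNNReal) 1 (θ i) 2
  refine (integral_mono h ((integrable_const (|θ i| + 1)).add h2) fun y => ?_).trans ?_
  · change |y| ≤ |θ i| + 1 + (y - θ i) ^ 2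
    have h3 := abs_add_le (θ i) (y - θ i)
    rw [add_sub_cancel] at h3
    nlinarith [sq_abs (y - θ i), sq_nonneg (|y - θ i| - 1 / 2)]
  · change ∫ y, (|θ i| + 1 + (y - θ i) ^ 2) ∂_ ≤ _
    rw [integral_add (integrable_const _) h2, integral_sub_sq, Real.coe_toNNReal _ (M.σp_pos i).le]
    simp
    linarith

theorem pastLaw_average_ge_le {n : ℕ} (hn : 0 < n) (θ : ℕ → ℝ) {A k r s ε : ℝ} (hε : 0 < ε)
    (hk : 0 ≤ k) (hr : 0 ≤ r) (hs : ∀ i, M.σp i ≤ s)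
    (hA : (1 / (n : ℝ)) * ∑ i ∈ Finset.range n, |θ i| ≤ A) :
    M.pastLaw θ n {x | ε ≤ k * ((1 / (n : ℝ)) * ∑ i, |x i| + r)}
      ≤ ENNReal.ofReal (k * (A + (1 + s) + r) / ε) := by
  have hn' : (0 : ℝ) < n := by exact_mod_cast hn
  have : IsProbabilityMeasure (M.pastLaw θ n) := by unfold pastLaw; infer_instance
  have hi : Integrable (fun x : Fin n → ℝ => ∑ i, |x i|) (M.pastLaw θ n) :=
    integrable_finsetSum _ fun i _ => M.integrable_abs_eval_pastLaw θ n i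
  have hint : Integrable (fun x : Fin n → ℝ => k * ((1 / (n : ℝ)) * ∑ i, |x i| + r))
      (M.pastLaw θ n) := ((hi.const_mul _).add (integrable_const _)).const_mul _
  have h1 := mul_meas_ge_le_integral_of_nonneg (μ := M.pastLaw θ n)
    (ae_of_all _ fun x => by positivity) hint ε
  rw [integral_const_mul, integral_add (hi.const_mul _) (integrable_const _), integral_const_mul,
    integral_finsetSum _ fun i _ => M.integrable_abs_eval_pastLaw θ n i] at h1
  have h2 : ∑ i : Fin n, ∫ x, |x i| ∂(M.pastLaw θ n)
      ≤ ∑ i ∈ Finset.range n, |θ i| + n * (1 + s) := by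
    refine (Finset.sum_le_sum fun i _ => M.integral_abs_eval_pastLaw_le θ n i (hs i)).trans ?_
    rw [Finset.sum_add_distrib, Finset.sum_range]
    simp
    exact le_of_eq (by ring)
  rw [← ofReal_measureReal]
  refine ENNReal.ofReal_le_ofReal ?_
  rw [le_div_iff₀ hε, mul_comm]
  refine h1.trans ?_
  simp only [integral_const, probReal_univ, one_smul]
  gcongr
  calc _ ≤ (1 / (n : ℝ)) * (∑ i ∈ Finset.range n, |θ i| + n * (1 + s)) := by gcongr
    _ = (1 / (n : ℝ)) * ∑ i ∈ Finset.range n, |θ i| + (1 + s) := by field_simp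
    _ ≤ _ := by gcongr

end Model

/-! ### Asymptotics of the mesh -/

theorem tendsto_log_atTop_nat : Tendsto (fun n : ℕ => Real.log n) atTop atTop :=
  Real.tendsto_log_atTop.comp tendsto_natCast_atTop_atTop

theorem tendsto_rate : Tendsto rate atTop atTop :=
  Real.tendsto_log_atTop.comp tendsto_log_atTop_nat

theorem tendsto_mesh {C₁ C₂ : ℝ} (h₁ : 0 < C₁) (h₂ : 0 < C₂) (C₃ C₄ : ℝ) :
    Tendsto (mesh C₁ C₂ C₃ C₄) atTop (𝓝 0) := by
  refine tendsto_inv_atTop_zero.comp (Tendsto.const_mul_atTop (by positivity) ?_)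
  have hs : Tendsto (fun n => Real.sqrt (rate n)) atTop atTop :=
    Real.tendsto_sqrt_atTop.comp tendsto_rate
  have h := tendsto_atTop_add_const_left atTop (2 * stdPdf 0 + C₃)
    (hs.atTop_mul_atTop₀ (tendsto_atTop_add_const_left atTop C₄ hs))
  refine h.congr' ?_
  filter_upwards [tendsto_rate.eventually_ge_atTop 0] with n hn
  have := Real.sq_sqrt hn
  linear_combination this

/-- The union bound: 1/δ_n grows like log log n, which is o(√log n). -/
theorem tendsto_inv_mesh_div (C₁ C₂ C₃ C₄ : ℝ) :
    Tendsto (fun n : ℕ => (1 / mesh C₁ C₂ C₃ C₄ n + 1) / Real.sqrt (Real.log n)) atTop (𝓝 0) := by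
  have hL := tendsto_log_atTop_nat
  have hs : Tendsto (fun n : ℕ => Real.sqrt (Real.log n)) atTop atTop :=
    Real.tendsto_sqrt_atTop.comp hL
  have h1 : Tendsto (fun n : ℕ => (Real.sqrt (Real.log n))⁻¹) atTop (𝓝 0) :=
    tendsto_inv_atTop_zero.comp hs
  have h2 : Tendsto (fun n : ℕ => rate n / Real.sqrt (Real.log n)) atTop (𝓝 0) := by
    have := (isLittleO_log_rpow_atTop (by norm_num : (0 : ℝ) < 1 / 2)).tendsto_div_nhds_zero
    refine (this.comp hL).congr fun n => ?_
    simp [rate, Real.sqrt_eq_rpow]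
  have h3 : Tendsto (fun n : ℕ => Real.sqrt (rate n) / Real.sqrt (Real.log n)) atTop (𝓝 0) := by
    refine squeeze_zero' (Eventually.of_forall fun n => by positivity) ?_ h2
    filter_upwards [tendsto_rate.eventually_ge_atTop 1] with n hn
    gcongr
    exact Real.sqrt_le_iff.2 ⟨by linarith, by nlinarith⟩
  have h := ((h1.const_mul (2 * C₁ * C₂ * (2 * stdPdf 0 + C₃) + 1)).add
    (h3.const_mul (2 * C₁ * C₂ * C₄))).add (h2.const_mul (2 * C₁ * C₂))
  simp only [mul_zero, add_zero] at h
  refine h.congr fun n => ?_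
  simp only [mesh, one_div, inv_inv]
  ring

end

end CheckLoss

/-! ### Optimality of the grid minimizer -/

theorem mainTheorem4 (M : CheckLoss.Model) (hA1 : M.AssumptionA1) (hA3 : M.AssumptionA3)
    (γ : ℕ → ℝ) (hγ : M.AdmissibleTuning γ)
    (θ : ℕ → ℝ) (hA2 : CheckLoss.AssumptionA2 θ)
    (C₁ C₂ C₃ C₄ : ℝ) (hC : M.AdmissibleConstants θ C₁ C₂ C₃ C₄)
    -- `τARE n x` is a minimizer of the risk estimate over the grid
    (τARE : (n : ℕ) → (Fin n → ℝ) → ℝ≥0∞)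
    (hARE_mem : ∀ n x, τARE n x ∈ CheckLoss.grid C₁ C₂ C₃ C₄ n)
    (hARE_min : ∀ n x, ∀ τ ∈ CheckLoss.grid C₁ C₂ C₃ C₄ n,
      M.ARE γ n x (τARE n x) ≤ M.ARE γ n x τ)
    -- `τOR n x` is a minimizer of the loss over `[0, ∞]`
    (τOR : (n : ℕ) → (Fin n → ℝ) → ℝ≥0∞)
    (hOR_min : ∀ n x, ∀ τ : ℝ≥0∞,
      M.loss n θ (M.predictor n (τOR n x) x) ≤ M.loss n θ (M.predictor n τ x))
    (ε : ℝ) (hε : 0 < ε) :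
    Tendsto (fun n : ℕ => M.pastLaw θ n
        {x | M.loss n θ (M.predictor n (τOR n x) x) + ε
              ≤ M.loss n θ (M.predictor n (τARE n x) x)})
      atTop (𝓝 0) := by
  obtain ⟨hC₁, hC₂, hC₃, -⟩ := id hC
  obtain ⟨-, ⟨s₀, hs₀⟩, -⟩ := hA3
  obtain ⟨A, hA⟩ := hA2
  have hC₁0 : 0 < C₁ := (add_pos (M.b_pos 0) (M.h_pos 0)).trans_le (hC₁ 0)
  have hC₂0 : 0 < C₂ := ((M.σp_pos 0).trans_le (le_max_left _ _)).trans_le (hC₂ 0)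
  have hC₃0 : 0 ≤ C₃ :=
    (mul_nonneg (div_pos (M.σp_pos 0) (M.σf_pos 0)).le (abs_nonneg _)).trans (hC₃ 0 0)
  have hσp : ∀ i, M.σp i ≤ C₂ := fun i => (le_max_left _ _).trans (hC₂ i)
  obtain ⟨C, hC0, hbound⟩ := M.coordError_bounds hγ hC₁
    (fun i => add_le_add (hs₀ i) (hσp i))
  set δ := CheckLoss.mesh C₁ C₂ C₃ C₄ with hδ
  have hδpos : ∀ n, 0 < δ n := CheckLoss.mesh_pos M θ C₁ C₂ C₃ C₄ hC
  set node : ℕ → ℕ → ℝ≥0∞ := fun n j =>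
    ENNReal.ofReal (j * δ n) / ENNReal.ofReal (1 - j * δ n) with hnode
  set r := Real.sqrt s₀ * C₃ with hr
  have hr0 : 0 ≤ r := by positivity
  set u₁ : ℕ → ℝ := fun n => C₁ * (C₂ * δ n) * (A + (1 + C₂) + r) / (ε / 3) with hu₁
  set u₂ : ℕ → ℝ := fun n => (C + C ^ 2) / (ε / 3) ^ 2
    * ((1 / δ n + 1) / Real.sqrt (Real.log n)) with hu₂
  have t₁ : Tendsto u₁ atTop (𝓝 0) := by
    have h := ((((CheckLoss.tendsto_mesh hC₁0 hC₂0 C₃ C₄).const_mul C₂).const_mul C₁).mul_const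
      (A + (1 + C₂) + r)).div_const (ε / 3)
    simpa using h
  have t₂ : Tendsto u₂ atTop (𝓝 0) := by
    simpa only [mul_zero] using (CheckLoss.tendsto_inv_mesh_div C₁ C₂ C₃ C₄).const_mul ((C + C ^ 2) / (ε / 3) ^ 2)
  have hlim : Tendsto (fun n => ENNReal.ofReal (u₁ n) + ENNReal.ofReal (u₂ n)) atTop (𝓝 0) := by
    simpa using (ENNReal.tendsto_ofReal t₁).add (ENNReal.tendsto_ofReal t₂)
  refine tendsto_of_tendsto_of_tendsto_of_le_of_le' tendsto_const_nhds hlim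
    (Eventually.of_forall fun _ => zero_le) ?_
  filter_upwards [hA, hbound, eventually_gt_atTop 0,
    CheckLoss.tendsto_log_atTop_nat.eventually_ge_atTop 1] with n hAn hbn hn hlog
  have hn' : (0 : ℝ) < n := by exact_mod_cast hn
  have hsq1 : 1 ≤ Real.sqrt (Real.log n) := Real.one_le_sqrt.2 hlog
  -- The union runs over the deterministic nodes, so neither minimizer has to be measurable:
  -- monotonicity of the outer measure suffices.
  have hsub : {x | M.loss n θ (M.predictor n (τOR n x) x) + ε
        ≤ M.loss n θ (M.predictor n (τARE n x) x)}
      ⊆ {x | ε / 3 ≤ C₁ * (C₂ * δ n) * ((1 / (n : ℝ)) * ∑ i, |x i| + r)}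
        ∪ ⋃ j ∈ Finset.range ⌈1 / δ n⌉₊,
          {x | ε / 3 ≤ |(1 / (n : ℝ)) * ∑ i : Fin n,
            M.coordError γ n i (node n j) (θ i) (x i)|} := by
    intro x hx
    have hx' : M.loss n θ (M.predictor n (τOR n x) x) + ε
      ≤ M.loss n θ (M.predictor n (τARE n x) x) := hx
    by_contra hnot
    simp only [Set.mem_union, Set.mem_ofPred_eq, Set.mem_iUnion, Finset.mem_range, not_or, not_exists,
      not_le] at hnot
    obtain ⟨h1, h2⟩ := hnot
    -- Off the bad events, with node k near the oracle: loss at `τARE` < ARE there + ε/3 ≤ ARE at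
    -- node k + ε/3 < loss at node k + 2ε/3 < oracle loss + ε.
    obtain ⟨k, hk, hkτ⟩ := M.exists_grid_near (hδpos n) hC₂ (τOR n x)
    obtain ⟨j, hj, hjτ⟩ := hARE_mem n x
    have e1 := M.loss_le_loss_add hn θ hC₁ hs₀ (fun i => hC₃ i i) hkτ x
    have e2 := hARE_min n x (node n k) ⟨k, hk, rfl⟩
    have e3 := h2 k hk
    have e4 := h2 j hj
    have hj' : node n j = τARE n x := hjτ
    rw [hj'] at e4
    rw [← M.ARE_sub_loss, abs_lt] at e3 e4
    have e1' : M.loss n θ (M.predictor n (node n k) x) ≤ M.loss n θ (M.predictor n (τOR n x) x)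
      + C₁ * (C₂ * δ n) * ((1 / (n : ℝ)) * ∑ i, |x i| + r) := e1
    linarith [e3.1, e3.2, e4.1, e4.2]
  refine (measure_mono hsub).trans ((measure_union_le _ _).trans (add_le_add ?_ ?_))
  · exact M.pastLaw_average_ge_le hn θ (by positivity) (by have := hδpos n; positivity) hr0 hσp hAn
  · refine (measure_biUnion_finset_le _ _).trans ?_
    refine (Finset.sum_le_card_nsmul _ _ (ENNReal.ofReal
      ((C + C ^ 2) / (ε / 3) ^ 2 / Real.sqrt (Real.log n))) fun j _ => ?_).trans ?_
    · refine (CheckLoss.pi_measure_abs_average_ge_le hn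
        (fun i => (hbn i (node n j) (θ i)).1) (by positivity)
        (fun i => (hbn i (node n j) (θ i)).2.1) fun i => (hbn i (node n j) (θ i)).2.2).trans ?_
      refine ENNReal.ofReal_le_ofReal ?_
      rw [div_right_comm]
      gcongr
      calc C * (n / Real.sqrt (Real.log n)) / n + (C / Real.sqrt (Real.log n)) ^ 2
          = C / Real.sqrt (Real.log n)
            + C ^ 2 / (Real.sqrt (Real.log n) * Real.sqrt (Real.log n)) := by
            field_simp
        _ ≤ C / Real.sqrt (Real.log n) + C ^ 2 / (Real.sqrt (Real.log n) * 1) := by gcongr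
        _ = (C + C ^ 2) / Real.sqrt (Real.log n) := by rw [mul_one, add_div]
    · rw [Finset.card_range, nsmul_eq_mul, ← ENNReal.ofReal_natCast,
        ← ENNReal.ofReal_mul (by positivity)]
      refine ENNReal.ofReal_le_ofReal ?_
      have hceil : (⌈1 / δ n⌉₊ : ℝ) ≤ 1 / δ n + 1 :=
        (Nat.ceil_lt_add_one (by have := hδpos n; positivity)).le
      calc _ ≤ (1 / δ n + 1) * ((C + C ^ 2) / (ε / 3) ^ 2 / Real.sqrt (Real.log n)) := by gcongr
        _ = u₂ n := by simp only [hu₂]; ring
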